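/- Let $N\in\mathbb N$ and let $p,\mu$ be real numbers with $1<p<N$ and $0\le\mu<\left(\frac{N-p}{p}\right)^p$. Put $p^*=\frac{Np}{N-p}$. For a domain (nonempty connected open set) $\Omega\subset\mathbb R^N$ let $\mathcal D^{1,p}(\Omega)$ be the set of weakly differentiable $w\in L^{p^*}(\Omega)$ with $\nabla w\in L^p(\Omega)$. Write $-L_pu=-\Delta_pu-\frac{\mu}{|x|^p}|u|^{p-2}u$, where $\Delta_pu=\operatorname{div}(|\nabla u|^{p-2}\nabla u)$. A function $u\in\mathcal D^{1,p}(\Omega)$ is a weak subsolution of $-L_pu=f|u|^{p-2}u$ in $\Omega$ if $$\int_\Omega\Big(|\nabla u|^{p-2}\nabla u\cdot\nabla\varphi-\frac{\mu}{|x|^p}|u|^{p-2}u\,\varphi\Big)\,dx\le\int_\Omega f|u|^{p-2}u\,\varphi\,dx\qquad\text{for all } 0\le\varphi\in C_0^\infty(\Omega),$$ and $v$ is a weak supersolution if $-v$ is a weak subsolution. **Theorem.** Let $\Omega\subset\mathbb R^N$ be a bounded domain and let $f,g\in L^{N/p}(\Omega)$ satisfy $f\le g$ a.e. in $\Omega$.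 Let $u\in\mathcal D^{1,p}(\Omega)$ be a weak subsolution of $-L_pu=f|u|^{p-2}u$ in $\Omega$ and let $v\in\mathcal D^{1,p}(\Omega)$ be a weak supersolution of $-L_pv=g|v|^{p-2}v$ in $\Omega$ such that $\operatorname{ess\,inf}_\Omega v>0$. If $u\le v$ on $\partial\Omega$, in the sense that $(u-v)^+\in W_0^{1,p}(\Omega)$ (the closure of $C_0^\infty(\Omega)$ in $W^{1,p}(\Omega)$), then $u\le v$ a.e. in $\Omega$. -/

import Mathlib

open MeasureTheory Filter Topology
open scoped ContDiff Gradient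

/-- `φ ∈ C₀^∞(Ω)`: a smooth real function on `ℝᴺ` with compact support contained in `Ω`. -/
structure IsTestFunction {N : ℕ} (Ω : Set (EuclideanSpace ℝ (Fin N)))
    (φ : EuclideanSpace ℝ (Fin N) → ℝ) : Prop where
  smooth : ContDiff ℝ ∞ φ
  hasCompactSupport : HasCompactSupport φ
  tsupport_subset : tsupport φ ⊆ Ω

/-- `G` is the weak gradient of `w` in the open set `Ω`: both are locally integrable in `Ω` and
`∫_Ω w ∇φ = - ∫_Ω φ G` for all test functions `φ`. -/
structure IsWeakGradient {N : ℕ} (Ω : Set (EuclideanSpace ℝ (Fin N)))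
    (w : EuclideanSpace ℝ (Fin N) → ℝ)
    (G : EuclideanSpace ℝ (Fin N) → EuclideanSpace ℝ (Fin N)) : Prop where
  locallyIntegrable : LocallyIntegrableOn w Ω volume
  locallyIntegrable_grad : LocallyIntegrableOn G Ω volume
  integral_eq : ∀ φ : EuclideanSpace ℝ (Fin N) → ℝ, IsTestFunction Ω φ →
    ∫ x in Ω, w x • (∇ φ) x = - ∫ x in Ω, φ x • G x

/-- `w ∈ 𝒟^{1,p}(Ω)` with weak gradient `G`: `w ∈ L^{p*}(Ω)` with `p* = Np/(N-p)`, and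
`G = ∇w ∈ L^p(Ω)`. -/
structure MemD1pWith {N : ℕ} (p : ℝ) (Ω : Set (EuclideanSpace ℝ (Fin N)))
    (w : EuclideanSpace ℝ (Fin N) → ℝ)
    (G : EuclideanSpace ℝ (Fin N) → EuclideanSpace ℝ (Fin N)) : Prop where
  memLp : MemLp w (ENNReal.ofReal (N * p / (N - p))) (volume.restrict Ω)
  isWeakGradient : IsWeakGradient Ω w G
  memLp_grad : MemLp G (ENNReal.ofReal p) (volume.restrict Ω)

/-- `u ∈ 𝒟^{1,p}(Ω)` is a weak subsolution in `Ω` of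
`-Δ_p u - (μ / |x|^p) |u|^{p-2} u = f |u|^{p-2} u`.  The weak gradient `G` of `u` is unique up to
a null set of `Ω`, so that it does not matter which one is used. -/
def IsWeakSubsolution {N : ℕ} (p μ : ℝ) (Ω : Set (EuclideanSpace ℝ (Fin N)))
    (f u : EuclideanSpace ℝ (Fin N) → ℝ) : Prop :=
  ∃ G : EuclideanSpace ℝ (Fin N) → EuclideanSpace ℝ (Fin N), MemD1pWith p Ω u G ∧
    ∀ φ : EuclideanSpace ℝ (Fin N) → ℝ, IsTestFunction Ω φ → (∀ x, 0 ≤ φ x) →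
      ∫ x in Ω, (‖G x‖ ^ (p - 2) * inner ℝ (G x) ((∇ φ) x)
          - μ / ‖x‖ ^ p * (|u x| ^ (p - 2) * u x) * φ x)
        ≤ ∫ x in Ω, f x * (|u x| ^ (p - 2) * u x) * φ x

/-- `v` is a weak supersolution if `-v` is a weak subsolution (the equation is odd in its
unknown). -/
def IsWeakSupersolution {N : ℕ} (p μ : ℝ) (Ω : Set (EuclideanSpace ℝ (Fin N)))
    (g v : EuclideanSpace ℝ (Fin N) → ℝ) : Prop :=
  IsWeakSubsolution p μ Ω g (fun x => - v x)

/-- `w ∈ W₀^{1,p}(Ω)`: `w` and its weak gradient are in `L^p(Ω)`, and `w` is the limit of test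
functions in the norm of `W^{1,p}(Ω)`. -/
def MemW01p {N : ℕ} (p : ℝ) (Ω : Set (EuclideanSpace ℝ (Fin N)))
    (w : EuclideanSpace ℝ (Fin N) → ℝ) : Prop :=
  ∃ G : EuclideanSpace ℝ (Fin N) → EuclideanSpace ℝ (Fin N), IsWeakGradient Ω w G ∧
    MemLp w (ENNReal.ofReal p) (volume.restrict Ω) ∧
    MemLp G (ENNReal.ofReal p) (volume.restrict Ω) ∧
    ∃ φ : ℕ → EuclideanSpace ℝ (Fin N) → ℝ, (∀ n, IsTestFunction Ω (φ n)) ∧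
      Tendsto (fun n => eLpNorm (fun x => φ n x - w x) (ENNReal.ofReal p) (volume.restrict Ω))
        atTop (𝓝 0) ∧
      Tendsto (fun n => eLpNorm (fun x => (∇ (φ n)) x - G x) (ENNReal.ofReal p)
        (volume.restrict Ω)) atTop (𝓝 0)

/-- `u ≤ v` on `∂Ω` in the Sobolev sense: `(u - v)⁺ ∈ W₀^{1,p}(Ω)`. -/
def LeOnBoundary {N : ℕ} (p : ℝ) (Ω : Set (EuclideanSpace ℝ (Fin N)))
    (u v : EuclideanSpace ℝ (Fin N) → ℝ) : Prop :=
  MemW01p p Ω (fun x => max (u x - v x) 0)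

/-! The argument is Picone's inequality on $\{u>v\}$. Formally, the inequality for $u$ is tested
with $u$ and the one for $v$ with $u^pv^{1-p}$, both restricted to $\{u>v\}$. Since $u^{p-1}\cdot
u=v^{p-1}\cdot u^pv^{1-p}$, the Hardy terms cancel and the potentials leave $\int(f-g)u^p\le 0$. The
gradient terms add up to a Picone remainder, which is nonnegative and vanishes only if $\nabla
u/u=\nabla v/v$. So $u/v$ has zero gradient on $\{u>v\}$, and the boundary condition leaves no room
for such a set.

Two modifications make the test functions admissible. The restriction to $\{u>v\}$ is done by the
smooth factor `cutoff (u / v)`; it is nondecreasing, so its derivative contributes a term with the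
good sign, by monotonicity of $x\mapsto|x|^{p-2}x$. Since $u$ may be unbounded, both test functions
carry the factor $(1+\varepsilon u)^{-p}$. This costs at most $(p-1)\int(1-(1+\varepsilon
u)^{-1})|\nabla u|^p$, which tends to $0$ with $\varepsilon$.

With $w=(u-v)^+$, every test function is a profile $F(v,v+w)$ vanishing on the diagonal.
`exists_isTestFunction_tendsto` makes it a limit of bounded nonnegative elements of
$C_0^\infty(\Omega)$, and `IsWeakGradient.ae_eq_of_posPart` identifies $\nabla(v+w)$ with $\nabla u$
on $\{u>v\}$. The cancellation is `abs_rpow_mul_subProfile`; the Picone estimate is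
`le_picone_combination`, applied in `piconeGap_le_profiles`. Finally `cutoff (u / v)` is a limit of
test functions whose gradients tend to zero, so it vanishes by `ae_eq_zero_of_tendsto_gradient`. -/

/-! ### Mollification in $L^p$. -/

section Mollification

open ContinuousLinearMap
open scoped Convolution ENNReal

variable {E F : Type*} [NormedAddCommGroup E] [NormedSpace ℝ E] [FiniteDimensional ℝ E]
  [MeasurableSpace E] [BorelSpace E] {μ : Measure E} [μ.IsAddHaarMeasure]
  [NormedAddCommGroup F] [NormedSpace ℝ F]

theorem lintegral_normed_eq_one (φ : ContDiffBump (0 : E)) :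
    ∫⁻ t, ENNReal.ofReal (φ.normed μ t) ∂μ = 1 := by
  rw [← ofReal_integral_eq_lintegral_ofReal φ.integrable_normed
    (Eventually.of_forall φ.nonneg_normed), φ.integral_normed, ENNReal.ofReal_one]

/-- Jensen's inequality for the power $p$, from Hölder's inequality against the constant 1. -/
theorem lintegral_rpow_le_of_isProbabilityMeasure {α : Type*} [MeasurableSpace α] {ν : Measure α}
    [IsProbabilityMeasure ν] {g : α → ℝ≥0∞} (hg : AEMeasurable g ν) {p : ℝ} (hp : 1 ≤ p) :
    (∫⁻ t, g t ∂ν) ^ p ≤ ∫⁻ t, g t ^ p ∂ν := by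
  have hp0 : 0 < p := by linarith
  rcases hp.eq_or_lt with rfl | hp1
  · simp
  have h := ENNReal.lintegral_mul_le_Lp_mul_Lq ν (Real.HolderConjugate.conjExponent hp1) hg
    (aemeasurable_const (b := (1 : ℝ≥0∞)))
  simp only [Pi.mul_apply, mul_one, ENNReal.one_rpow, lintegral_one, measure_univ] at h
  calc (∫⁻ t, g t ∂ν) ^ p ≤ ((∫⁻ t, g t ^ p ∂ν) ^ (1 / p)) ^ p := by gcongr
    _ = _ := by rw [← ENNReal.rpow_mul, one_div_mul_cancel hp0.ne', ENNReal.rpow_one]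

/-- Mollification does not increase the `L^p` norm. -/
theorem eLpNorm_normed_convolution_le (φ : ContDiffBump (0 : E)) {f : E → F}
    (hf : AEStronglyMeasurable f μ) {p : ℝ} (hp : 1 ≤ p) :
    eLpNorm (φ.normed μ ⋆[lsmul ℝ ℝ, μ] f) (ENNReal.ofReal p) μ
      ≤ eLpNorm f (ENNReal.ofReal p) μ := by
  have hp0 : 0 < p := by linarith
  wlog hfm : StronglyMeasurable f generalizing f
  · have h := this hf.stronglyMeasurable_mk.aestronglyMeasurable hf.stronglyMeasurable_mk
    rw [convolution_congr (lsmul ℝ ℝ) (ae_eq_refl _) hf.ae_eq_mk, eLpNorm_congr_ae hf.ae_eq_mk]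
    exact h
  have hρ : Measurable fun t => ENNReal.ofReal (φ.normed μ t) :=
    (φ.continuous_normed (μ := μ)).measurable.ennreal_ofReal
  -- With respect to this probability measure the convolution averages translates of `f`. Jensen is
  -- applied at each point, then Tonelli and translation invariance.
  set ν : Measure E := μ.withDensity fun t => ENNReal.ofReal (φ.normed μ t) with hν
  have hprob : IsProbabilityMeasure ν := by
    constructor
    rw [hν, withDensity_apply _ MeasurableSet.univ, setLIntegral_univ, lintegral_normed_eq_one]
  have hm : Measurable fun z : E × E => ‖f (z.1 - z.2)‖ₑ ^ p :=
    ((hfm.enorm.comp measurable_sub).pow_const p)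
  have hpt : ∀ x, ‖(φ.normed μ ⋆[lsmul ℝ ℝ, μ] f) x‖ₑ ^ p ≤ ∫⁻ t, ‖f (x - t)‖ₑ ^ p ∂ν := by
    intro x
    have hmx : Measurable fun t => ‖f (x - t)‖ₑ := hfm.enorm.comp (measurable_const_sub x)
    refine le_trans ?_ (lintegral_rpow_le_of_isProbabilityMeasure hmx.aemeasurable hp)
    gcongr
    rw [hν, lintegral_withDensity_eq_lintegral_mul _ hρ hmx, convolution_def]
    refine (enorm_integral_le_lintegral_enorm _).trans (lintegral_mono fun t => ?_)
    rw [lsmul_apply, enorm_smul, Real.enorm_of_nonneg (φ.nonneg_normed t)]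
    rfl
  rw [eLpNorm_eq_lintegral_rpow_enorm_toReal (by simpa using hp0) (by simp),
    eLpNorm_eq_lintegral_rpow_enorm_toReal (by simpa using hp0) (by simp),
    ENNReal.toReal_ofReal hp0.le]
  gcongr ?_ ^ (1 / p)
  calc ∫⁻ x, ‖(φ.normed μ ⋆[lsmul ℝ ℝ, μ] f) x‖ₑ ^ p ∂μ
      ≤ ∫⁻ x, ∫⁻ t, ‖f (x - t)‖ₑ ^ p ∂ν ∂μ := lintegral_mono hpt
    _ = ∫⁻ t, ∫⁻ x, ‖f (x - t)‖ₑ ^ p ∂μ ∂ν := lintegral_lintegral_swap hm.aemeasurable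
    _ = ∫⁻ _, ∫⁻ x, ‖f x‖ₑ ^ p ∂μ ∂ν := by
        refine lintegral_congr fun t => ?_
        exact lintegral_sub_right_eq_self (fun x => ‖f x‖ₑ ^ p) t
    _ = _ := by simp

/-- Mollifications of an `L^p` function converge to it in `L^p`. -/
theorem tendsto_eLpNorm_normed_convolution_sub [CompleteSpace F] {φ : ℕ → ContDiffBump (0 : E)}
    (hφ : Tendsto (fun n => (φ n).rOut) atTop (𝓝 0)) {f : E → F} {p : ℝ} (hp : 1 ≤ p)
    (hf : MemLp f (ENNReal.ofReal p) μ) :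
    Tendsto (fun n => eLpNorm (fun x => ((φ n).normed μ ⋆[lsmul ℝ ℝ, μ] f) x - f x)
      (ENNReal.ofReal p) μ) atTop (𝓝 0) := by
  have hp1 : 1 ≤ ENNReal.ofReal p := by simpa using ENNReal.ofReal_le_ofReal hp
  have hfl : LocallyIntegrable f μ := hf.locallyIntegrable hp1
  rw [ENNReal.tendsto_nhds_zero]
  intro ε hε
  have hε3 : ε / 3 ≠ 0 := by simpa using hε.ne'
  obtain ⟨g, hgc, hfg, hg, hgm⟩ := hf.exists_hasCompactSupport_eLpNorm_sub_le ENNReal.ofReal_ne_top hε3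
  -- For continuous compactly supported `g` the error is at most `η` everywhere and, once the radius
  -- is below 1, vanishes off the 1-neighbourhood `K` of the support. Its norm is then at most
  -- $\mu(K)^{1/p}\eta$.
  have key : ∀ᶠ n in atTop, eLpNorm (fun x => ((φ n).normed μ ⋆[lsmul ℝ ℝ, μ] g) x - g x)
      (ENNReal.ofReal p) μ ≤ ε / 3 := by
    set K := Metric.cthickening 1 (tsupport g) with hK
    have hKc : IsCompact K := hgc.isCompact.cthickening
    obtain ⟨η, hη, hηK⟩ : ∃ η : ℝ, 0 < η ∧
        μ K ^ (ENNReal.ofReal p).toReal⁻¹ * ENNReal.ofReal η ≤ ε / 3 := by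
      have hfin : μ K ^ (ENNReal.ofReal p).toReal⁻¹ ≠ ⊤ :=
        ENNReal.rpow_ne_top_of_nonneg (by positivity) hKc.measure_lt_top.ne
      have ht : Tendsto (fun η : ℝ => μ K ^ (ENNReal.ofReal p).toReal⁻¹ * ENNReal.ofReal η)
          (𝓝[>] 0) (𝓝 0) := by
        have := ENNReal.Tendsto.const_mul (a := μ K ^ (ENNReal.ofReal p).toReal⁻¹)
          ((ENNReal.continuous_ofReal.tendsto 0).mono_left (nhdsWithin_le_nhds (s := Set.Ioi 0)))
          (Or.inr hfin)
        simpa using this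
      have h2 := (ht.eventually (gt_mem_nhds (pos_iff_ne_zero.2 hε3))).and self_mem_nhdsWithin
      obtain ⟨η, h1, h2⟩ := h2.exists
      exact ⟨η, h2, h1.le⟩
    obtain ⟨δ, hδ, hδg⟩ := Metric.uniformContinuous_iff.1
      (hgc.uniformContinuous_of_continuous hg) η hη
    filter_upwards [hφ.eventually (gt_mem_nhds hδ), hφ.eventually (gt_mem_nhds one_pos)]
      with n hn hn1
    have hb : ∀ x, ‖((φ n).normed μ ⋆[lsmul ℝ ℝ, μ] g) x - g x‖ ≤ η := by
      intro x
      rw [← dist_eq_norm]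
      refine (φ n).dist_normed_convolution_le hg.aestronglyMeasurable fun y hy => ?_
      exact (hδg ((Metric.mem_ball.1 hy).trans hn)).le
    have hs : ∀ x, x ∉ K → ((φ n).normed μ ⋆[lsmul ℝ ℝ, μ] g) x - g x = 0 := by
      intro x hx
      have hball : ∀ y ∈ Metric.ball x (φ n).rOut, g y = g x := by
        have hz : ∀ y ∈ Metric.ball x 1, g y = 0 := by
          intro y hy
          by_contra hne
          exact hx (Metric.mem_cthickening_of_dist_le x y 1 _ (subset_tsupport _ hne)
            (by rw [dist_comm]; exact (Metric.mem_ball.1 hy).le))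
        intro y hy
        rw [hz y (Metric.ball_subset_ball hn1.le hy), hz x (Metric.mem_ball_self one_pos)]
      rw [(φ n).normed_convolution_eq_right hball, sub_self]
    have hind : (fun x => ((φ n).normed μ ⋆[lsmul ℝ ℝ, μ] g) x - g x)
        = K.indicator (fun x => ((φ n).normed μ ⋆[lsmul ℝ ℝ, μ] g) x - g x) := by
      ext x
      by_cases hx : x ∈ K
      · rw [Set.indicator_of_mem hx]
      · rw [Set.indicator_of_notMem hx, hs x hx]
    rw [hind, eLpNorm_indicator_eq_eLpNorm_restrict hKc.measurableSet]
    refine (eLpNorm_le_of_ae_bound (Eventually.of_forall hb)).trans ?_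
    rwa [Measure.restrict_apply_univ]
  filter_upwards [key] with n hn
  have hint : ∀ {h : E → F}, LocallyIntegrable h μ →
      ConvolutionExists ((φ n).normed μ) h (lsmul ℝ ℝ) μ := fun hh =>
    (φ n).hasCompactSupport_normed.convolutionExists_left _ (φ n).continuous_normed hh
  have hgl : LocallyIntegrable g μ := hg.locallyIntegrable
  have hsub : (φ n).normed μ ⋆[lsmul ℝ ℝ, μ] f
      = ((φ n).normed μ ⋆[lsmul ℝ ℝ, μ] (f - g)) + ((φ n).normed μ ⋆[lsmul ℝ ℝ, μ] g) := by
    rw [← ConvolutionExists.distrib_add (hint (hfl.sub hgl)) (hint hgl), sub_add_cancel]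
  have hdec : (fun x => ((φ n).normed μ ⋆[lsmul ℝ ℝ, μ] f) x - f x)
      = ((φ n).normed μ ⋆[lsmul ℝ ℝ, μ] (f - g))
        + (fun x => ((φ n).normed μ ⋆[lsmul ℝ ℝ, μ] g) x - g x) + (g - f) := by
    ext x
    simp only [hsub, Pi.add_apply, Pi.sub_apply]
    abel
  have hcm : ∀ {h : E → F}, LocallyIntegrable h μ →
      AEStronglyMeasurable ((φ n).normed μ ⋆[lsmul ℝ ℝ, μ] h) μ := fun hh =>
    ((φ n).hasCompactSupport_normed.continuous_convolution_left _ (φ n).continuous_normed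
      hh).aestronglyMeasurable
  have hfgm := hf.1.sub hgm.1
  rw [hdec]
  refine (eLpNorm_add_le ((hcm (hfl.sub hgl)).add ((hcm hgl).sub hgm.1)) (hgm.1.sub hf.1)
    hp1).trans ?_
  have h1 := eLpNorm_add_le (hcm (hfl.sub hgl)) ((hcm hgl).sub hgm.1) hp1
  have h2 := (eLpNorm_normed_convolution_le (φ n) hfgm hp).trans hfg
  have h3 : eLpNorm (g - f) (ENNReal.ofReal p) μ ≤ ε / 3 := by
    rw [eLpNorm_sub_comm]; exact hfg
  calc _ ≤ (ε / 3 + ε / 3) + ε / 3 := add_le_add (h1.trans (add_le_add h2 hn)) h3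
    _ = ε := ENNReal.add_thirds ε

end Mollification

/-! ### Smooth approximation of weakly differentiable functions. -/

section WeakGradient

open ContinuousLinearMap
open scoped Convolution

theorem HasFDerivAt.hasGradientAt_of_toDual_eq {H : Type*} [NormedAddCommGroup H]
    [InnerProductSpace ℝ H] [CompleteSpace H] {f : H → ℝ} {L : H →L[ℝ] ℝ} {g x : H}
    (h : HasFDerivAt f L x) (hL : InnerProductSpace.toDual ℝ H g = L) : HasGradientAt f g x := by
  subst hL
  exact hasGradientAt_iff_hasFDerivAt.2 h

variable {N : ℕ} {Ω : Set (EuclideanSpace ℝ (Fin N))} {v : EuclideanSpace ℝ (Fin N) → ℝ}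
  {V : EuclideanSpace ℝ (Fin N) → EuclideanSpace ℝ (Fin N)}

/-- The gradient of a mollification is the mollification of the weak gradient. -/
theorem IsWeakGradient.gradient_normed_convolution (hw : IsWeakGradient Ω v V)
    (hΩ : MeasurableSet Ω) (hv : IntegrableOn v Ω)
    (φ : ContDiffBump (0 : EuclideanSpace ℝ (Fin N))) {x : EuclideanSpace ℝ (Fin N)}
    (hx : Metric.closedBall x φ.rOut ⊆ Ω) :
    (∇ (φ.normed volume ⋆[lsmul ℝ ℝ, volume] Ω.indicator v)) x
      = (φ.normed volume ⋆[lsmul ℝ ℝ, volume] Ω.indicator V) x := by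
  set ρ := φ.normed (volume : Measure (EuclideanSpace ℝ (Fin N))) with hρ
  have hρs : ContDiff ℝ ∞ ρ := φ.contDiff_normed
  have hρc : HasCompactSupport ρ := φ.hasCompactSupport_normed
  have hvi : LocallyIntegrable (Ω.indicator v) volume :=
    ((integrable_indicator_iff hΩ).2 hv).locallyIntegrable
  have hd := hρc.hasFDerivAt_convolution_left (lsmul ℝ ℝ) (hρs.of_le (by simp)) hvi x
  have hψd : ∀ t, HasGradientAt (fun t => ρ (x - t)) (-(∇ ρ) (x - t)) t := by
    intro t
    have h1 : HasFDerivAt ρ (fderiv ℝ ρ (x - t)) (x - t) :=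
      (hρs.differentiable (by simp) _).hasFDerivAt
    have h2 : HasFDerivAt (fun t => x - t) (-ContinuousLinearMap.id ℝ _) t :=
      (hasFDerivAt_id t).const_sub x
    refine (h1.comp t h2).hasGradientAt_of_toDual_eq ?_
    rw [map_neg, toDual_gradient]
    ext; simp
  -- The reflected bump is admissible because its ball lies in `Ω`. The sign from the reflection
  -- cancels the sign in the definition of the weak gradient.
  have hψ : IsTestFunction Ω fun t => ρ (x - t) := by
    have hts : tsupport (fun t => ρ (x - t)) ⊆ Metric.closedBall x φ.rOut := by
      refine closure_minimal (fun t ht => ?_) Metric.isClosed_closedBall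
      have : x - t ∈ Function.support ρ := ht
      rw [hρ, φ.support_normed_eq, mem_ball_zero_iff] at this
      rw [Metric.mem_closedBall, dist_comm, dist_eq_norm]
      exact this.le
    refine ⟨hρs.comp (contDiff_const.sub contDiff_id), ?_, hts.trans hx⟩
    exact (isCompact_closedBall x φ.rOut).of_isClosed_subset (isClosed_tsupport _) hts
  have hI := hw.integral_eq _ hψ
  simp only [fun t => (hψd t).gradient, smul_neg, integral_neg, neg_inj] at hI
  have hR : (ρ ⋆[lsmul ℝ ℝ, volume] Ω.indicator V) x = ∫ t in Ω, ρ (x - t) • V t := by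
    rw [convolution_eq_swap, ← integral_indicator hΩ]
    refine integral_congr_ae (Eventually.of_forall fun t => ?_)
    by_cases ht : t ∈ Ω <;> simp [ht]
  rw [hR, ← hI]
  refine (hd.hasGradientAt_of_toDual_eq ?_).gradient
  rw [convolution_eq_swap, ← integral_indicator hΩ,
    ← LinearIsometryEquiv.coe_toContinuousLinearEquiv, ← ContinuousLinearEquiv.integral_comp_comm]
  refine integral_congr_ae (Eventually.of_forall fun t => ?_)
  by_cases ht : t ∈ Ω
  · ext y
    simp [ht, mul_comm, precompL_apply, ← inner_gradient_left]
  · simp [ht]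

/-- Local approximation of a weakly differentiable function by smooth functions. -/
theorem IsWeakGradient.exists_contDiff_tendsto (hw : IsWeakGradient Ω v V) (hΩ : IsOpen Ω)
    {p : ℝ} (hp : 1 ≤ p) (hv : IntegrableOn v Ω)
    (hV : MemLp V (ENNReal.ofReal p) (volume.restrict Ω))
    {K : Set (EuclideanSpace ℝ (Fin N))} (hK : IsCompact K) (hKΩ : K ⊆ Ω) :
    ∃ z : ℕ → EuclideanSpace ℝ (Fin N) → ℝ, (∀ n, ContDiff ℝ ∞ (z n)) ∧
      (∀ c : ℝ, (∀ᵐ x ∂(volume.restrict Ω), c ≤ v x) → ∀ n, ∀ x ∈ K, c ≤ z n x) ∧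
      Tendsto (fun n => eLpNorm (fun x => z n x - v x) 1 (volume.restrict K)) atTop (𝓝 0) ∧
      Tendsto (fun n => eLpNorm (fun x => (∇ (z n)) x - V x) (ENNReal.ofReal p)
        (volume.restrict K)) atTop (𝓝 0) := by
  -- With radii at most `δ`, every average centred in `K` uses values inside `Ω` only, so the
  -- extension by zero does not spoil the gradient formula or the lower bound.
  obtain ⟨δ, hδ, hδΩ⟩ := hK.exists_cthickening_subset_open hΩ hKΩ
  set φ : ℕ → ContDiffBump (0 : EuclideanSpace ℝ (Fin N)) := fun n =>
    { rIn := δ / (n + 2)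
      rOut := δ / (n + 1)
      rIn_pos := by positivity
      rIn_lt_rOut := by gcongr; norm_num } with hφdef
  have hφ : Tendsto (fun n => (φ n).rOut) atTop (𝓝 0) := by
    have := (tendsto_one_div_add_atTop_nhds_zero_nat (𝕜 := ℝ)).const_mul δ
    simpa [hφdef, div_eq_mul_inv] using this
  have hball : ∀ n, ∀ x ∈ K, Metric.closedBall x (φ n).rOut ⊆ Ω := by
    intro n x hx
    have h1 : (φ n).rOut ≤ δ := div_le_self hδ.le (by simp)
    exact ((Metric.closedBall_subset_closedBall h1).trans
      (Metric.closedBall_subset_cthickening hx δ)).trans hδΩ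
  have hvi : Integrable (Ω.indicator v) volume := (integrable_indicator_iff hΩ.measurableSet).2 hv
  have hv1 : MemLp (Ω.indicator v) (ENNReal.ofReal 1) volume := by
    rw [ENNReal.ofReal_one]; exact memLp_one_iff_integrable.2 hvi
  have hVi : MemLp (Ω.indicator V) (ENNReal.ofReal p) volume :=
    (memLp_indicator_iff_restrict hΩ.measurableSet).2 hV
  refine ⟨fun n => (φ n).normed volume ⋆[lsmul ℝ ℝ, volume] Ω.indicator v, ?_, ?_, ?_, ?_⟩
  · exact fun n => (φ n).hasCompactSupport_normed.contDiff_convolution_left _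
      (φ n).contDiff_normed hvi.locallyIntegrable
  · intro c hc n x hx
    rw [ae_restrict_iff' hΩ.measurableSet] at hc
    have hex := ((φ n).hasCompactSupport_normed (μ := volume)).convolutionExists_left
      (lsmul ℝ ℝ) (φ n).continuous_normed hvi.locallyIntegrable x
    have h1 : ∫ t, (φ n).normed volume (x - t) * c = c := by
      rw [integral_mul_const, integral_sub_left_eq_self ((φ n).normed volume) volume x,
        (φ n).integral_normed, one_mul]
    have hi1 : Integrable (fun t => (φ n).normed volume (x - t) * c) volume :=
      ((φ n).integrable_normed.comp_sub_left x).mul_const c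
    beta_reduce
    rw [convolution_eq_swap]
    calc c = ∫ t, (φ n).normed volume (x - t) * c := h1.symm
      _ ≤ _ := by
        refine integral_mono_ae hi1 hex.integrable_swap ?_
        filter_upwards [hc] with t ht
        simp only [lsmul_apply, smul_eq_mul]
        by_cases hb : x - t ∈ Function.support ((φ n).normed volume)
        · have htΩ : t ∈ Ω := by
            apply hball n x hx
            rw [(φ n).support_normed_eq, mem_ball_zero_iff] at hb
            rw [Metric.mem_closedBall, dist_comm, dist_eq_norm]
            exact hb.le
          rw [Set.indicator_of_mem htΩ]
          exact mul_le_mul_of_nonneg_left (ht htΩ) ((φ n).nonneg_normed _)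
        · rw [Function.notMem_support.1 hb, zero_mul, zero_mul]
  · have h := tendsto_eLpNorm_normed_convolution_sub hφ le_rfl hv1
    rw [ENNReal.ofReal_one] at h
    refine tendsto_of_tendsto_of_tendsto_of_le_of_le tendsto_const_nhds h (fun _ => zero_le)
      fun n => ?_
    refine le_trans (le_of_eq ?_) (eLpNorm_mono_measure _ (Measure.restrict_le_self (s := K)))
    refine eLpNorm_congr_ae ?_
    filter_upwards [ae_restrict_mem hK.measurableSet] with x hx
    rw [Set.indicator_of_mem (hKΩ hx)]
  · have h := tendsto_eLpNorm_normed_convolution_sub hφ hp hVi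
    refine tendsto_of_tendsto_of_tendsto_of_le_of_le tendsto_const_nhds h (fun _ => zero_le)
      fun n => ?_
    refine le_trans (le_of_eq ?_) (eLpNorm_mono_measure _ (Measure.restrict_le_self (s := K)))
    refine eLpNorm_congr_ae ?_
    filter_upwards [ae_restrict_mem hK.measurableSet] with x hx
    rw [hw.gradient_normed_convolution hΩ.measurableSet hv (φ n) (hball n x hx),
      Set.indicator_of_mem (hKΩ hx)]

end WeakGradient

/-! ### Products of bounded factors with $L^p$ functions. -/

section LpLimits

variable {α F : Type*} [MeasurableSpace α] {μ : Measure α} [NormedAddCommGroup F] [NormedSpace ℝ F]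

/-- Dominated convergence in `L^p` for products of a bounded and a fixed `L^p` function. -/
theorem tendsto_eLpNorm_smul_of_bounded {p : ℝ} (hp : 0 < p) {c : ℕ → α → ℝ} {f : α → F}
    (hc : ∀ n, AEStronglyMeasurable (c n) μ) {M : ℝ} (hM : ∀ n, ∀ᵐ x ∂μ, |c n x| ≤ M)
    (hlim : ∀ᵐ x ∂μ, Tendsto (fun n => c n x) atTop (𝓝 0)) (hf : MemLp f (ENNReal.ofReal p) μ) :
    Tendsto (fun n => eLpNorm (fun x => c n x • f x) (ENNReal.ofReal p) μ) atTop (𝓝 0) := by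
  have hp' : ENNReal.ofReal p ≠ 0 := by simpa using hp
  simp only [eLpNorm_eq_lintegral_rpow_enorm_toReal hp' ENNReal.ofReal_ne_top,
    ENNReal.toReal_ofReal hp.le]
  have hfin : ∫⁻ x, (ENNReal.ofReal M * ‖f x‖ₑ) ^ p ∂μ ≠ ⊤ := by
    simp only [ENNReal.mul_rpow_of_nonneg _ _ hp.le]
    rw [lintegral_const_mul' _ _ (ENNReal.rpow_ne_top_of_nonneg hp.le ENNReal.ofReal_ne_top)]
    refine ENNReal.mul_ne_top (ENNReal.rpow_ne_top_of_nonneg hp.le ENNReal.ofReal_ne_top) ?_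
    have := lintegral_rpow_enorm_lt_top_of_eLpNorm_lt_top hp' ENNReal.ofReal_ne_top hf.2
    rw [ENNReal.toReal_ofReal hp.le] at this
    exact this.ne
  have h : Tendsto (fun n => ∫⁻ x, ‖c n x • f x‖ₑ ^ p ∂μ) atTop (𝓝 (∫⁻ _, 0 ∂μ)) := by
    refine tendsto_lintegral_of_dominated_convergence' _ (fun n => ?_) (fun n => ?_) hfin ?_
    · exact ((hc n).smul hf.1).enorm.pow_const p
    · filter_upwards [hM n] with x hx
      rw [enorm_smul]
      gcongr
      rw [Real.enorm_eq_ofReal_abs]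
      exact ENNReal.ofReal_le_ofReal hx
    · filter_upwards [hlim] with x hx
      have h1 : Tendsto (fun n => ‖c n x • f x‖ₑ) atTop (𝓝 0) := by
        have := (hx.smul_const (f x)).enorm
        simpa using this
      have := h1.ennrpow_const p
      rwa [ENNReal.zero_rpow_of_pos hp] at this
  rw [lintegral_zero] at h
  have := h.ennrpow_const (1 / p)
  rwa [ENNReal.zero_rpow_of_pos (by positivity)] at this

/-- Bounded a.e. convergent factors preserve convergence in `L^p`. -/
theorem tendsto_eLpNorm_smul_sub_smul {p : ℝ} (hp : 1 ≤ p) {c : ℕ → α → ℝ} {c₀ : α → ℝ}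
    {f : ℕ → α → F} {f₀ : α → F} (hc : ∀ n, AEStronglyMeasurable (c n) μ)
    {M : ℝ} (hM : ∀ n, ∀ᵐ x ∂μ, |c n x| ≤ M)
    (hlim : ∀ᵐ x ∂μ, Tendsto (fun n => c n x) atTop (𝓝 (c₀ x)))
    (hfm : ∀ n, AEStronglyMeasurable (f n) μ) (hf : MemLp f₀ (ENNReal.ofReal p) μ)
    (h : Tendsto (fun n => eLpNorm (fun x => f n x - f₀ x) (ENNReal.ofReal p) μ) atTop (𝓝 0)) :
    Tendsto (fun n => eLpNorm (fun x => c n x • f n x - c₀ x • f₀ x) (ENNReal.ofReal p) μ)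
      atTop (𝓝 0) := by
  have hp1 : 1 ≤ ENNReal.ofReal p := by simpa using ENNReal.ofReal_le_ofReal hp
  have hc₀ : AEStronglyMeasurable c₀ μ := aestronglyMeasurable_of_tendsto_ae atTop hc hlim
  have hMall : ∀ᵐ x ∂μ, ∀ n, |c n x| ≤ M := ae_all_iff.2 hM
  have h1 : Tendsto (fun n => eLpNorm (fun x => (c n x - c₀ x) • f₀ x) (ENNReal.ofReal p) μ)
      atTop (𝓝 0) := by
    refine tendsto_eLpNorm_smul_of_bounded (by linarith) (fun n => (hc n).sub hc₀) (M := 2 * M)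
      (fun n => ?_) ?_ hf
    · filter_upwards [hMall, hlim] with x hx hl
      have h0 : |c₀ x| ≤ M := le_of_tendsto' hl.abs hx
      have h2 := abs_sub (c n x) (c₀ x)
      linarith [hx n]
    · filter_upwards [hlim] with x hl
      simpa using hl.sub_const (c₀ x)
  have h2 : Tendsto (fun n => ENNReal.ofReal M *
      eLpNorm (fun x => f n x - f₀ x) (ENNReal.ofReal p) μ) atTop (𝓝 0) := by
    simpa using ENNReal.Tendsto.const_mul h (Or.inr (ENNReal.ofReal_ne_top (r := M)))
  have h3 := h2.add h1
  rw [add_zero] at h3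
  refine tendsto_of_tendsto_of_tendsto_of_le_of_le tendsto_const_nhds h3 (fun _ => zero_le)
    fun n => ?_
  -- The first summand is small by the uniform bound on `c n`, the second by dominated convergence.
  have hdec : (fun x => c n x • f n x - c₀ x • f₀ x)
      = (fun x => c n x • (f n x - f₀ x)) + fun x => (c n x - c₀ x) • f₀ x := by
    ext x
    simp only [Pi.add_apply, smul_sub, sub_smul]
    abel
  rw [hdec]
  refine (eLpNorm_add_le ((hc n).smul ((hfm n).sub hf.1)) (((hc n).sub hc₀).smul hf.1) hp1).trans ?_
  refine add_le_add ?_ le_rfl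
  refine eLpNorm_le_mul_eLpNorm_of_ae_le_mul ?_ _
  filter_upwards [hM n] with x hx
  calc ‖c n x • (f n x - f₀ x)‖ = |c n x| * ‖f n x - f₀ x‖ := by
        rw [norm_smul, Real.norm_eq_abs]
    _ ≤ M * ‖f n x - f₀ x‖ := by gcongr

end LpLimits

/-! ### Chain rule and gradients of positive parts. -/

section ChainRule

variable {N : ℕ} {Ω : Set (EuclideanSpace ℝ (Fin N))}

theorem ContDiff.continuous_gradient {a : EuclideanSpace ℝ (Fin N) → ℝ} (ha : ContDiff ℝ 1 a) :
    Continuous (∇ a) :=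
  (InnerProductSpace.toDual ℝ _).symm.continuous.comp (ha.continuous_fderiv one_ne_zero)

theorem gradient_eq_zero_of_notMem_tsupport {a : EuclideanSpace ℝ (Fin N) → ℝ}
    {x : EuclideanSpace ℝ (Fin N)} (hx : x ∉ tsupport a) : (∇ a) x = 0 := by
  rw [(notMem_tsupport_iff_eventuallyEq.1 hx).gradient_eq]
  exact gradient_fun_const x 0

theorem HasCompactSupport.gradient {a : EuclideanSpace ℝ (Fin N) → ℝ} (ha : HasCompactSupport a) :
    HasCompactSupport (∇ a) :=
  HasCompactSupport.intro ha fun _ hx => gradient_eq_zero_of_notMem_tsupport hx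

theorem IsTestFunction.exists_gradient_bound {φ : EuclideanSpace ℝ (Fin N) → ℝ}
    (hφ : IsTestFunction Ω φ) : ∃ M, ∀ x, ‖(∇ φ) x‖ ≤ M :=
  (hφ.smooth.of_le (by simp)).continuous_gradient.bounded_above_of_compact_support
    hφ.hasCompactSupport.gradient

theorem IsTestFunction.exists_bound {φ : EuclideanSpace ℝ (Fin N) → ℝ}
    (hφ : IsTestFunction Ω φ) : ∃ M, ∀ x, ‖φ x‖ ≤ M :=
  hφ.smooth.continuous.bounded_above_of_compact_support hφ.hasCompactSupport

theorem integral_smul_gradient_eq_neg {a φ : EuclideanSpace ℝ (Fin N) → ℝ} (ha : ContDiff ℝ 1 a)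
    (hφ : ContDiff ℝ 1 φ) (hc : HasCompactSupport φ) :
    ∫ x, a x • (∇ φ) x = - ∫ x, φ x • (∇ a) x := by
  have hi1 : Integrable (fun x => a x • (∇ φ) x) :=
    (ha.continuous.smul hφ.continuous_gradient).integrable_of_hasCompactSupport
      hc.gradient.smul_left
  have hi2 : Integrable (fun x => φ x • (∇ a) x) :=
    (hφ.continuous.smul ha.continuous_gradient).integrable_of_hasCompactSupport hc.smul_right
  refine ext_inner_left ℝ fun e => ?_
  rw [inner_neg_right, ← integral_inner hi1, ← integral_inner hi2]
  simp only [inner_smul_right, inner_gradient_right, conj_trivial]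
  rw [integral_mul_fderiv_eq_neg_fderiv_mul_of_integrable]
  · simp only [mul_comm]
  · have := hi2.const_inner (𝕜 := ℝ) e
    simpa only [inner_smul_right, inner_gradient_right, conj_trivial, mul_comm] using this
  · have := hi1.const_inner (𝕜 := ℝ) e
    simpa only [inner_smul_right, inner_gradient_right, conj_trivial] using this
  · exact (ha.continuous.mul hφ.continuous).integrable_of_hasCompactSupport hc.mul_left
  · exact fun x _ => ha.differentiable one_ne_zero x
  · exact fun x _ => hφ.differentiable one_ne_zero x

variable {w : EuclideanSpace ℝ (Fin N) → ℝ}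
  {G : EuclideanSpace ℝ (Fin N) → EuclideanSpace ℝ (Fin N)}

theorem IsTestFunction.integrableOn_smul_gradient {φ : EuclideanSpace ℝ (Fin N) → ℝ}
    (hφ : IsTestFunction Ω φ) (hw : IntegrableOn w Ω) :
    IntegrableOn (fun x => w x • (∇ φ) x) Ω := by
  obtain ⟨M, hM⟩ := hφ.exists_gradient_bound
  refine (hw.norm.mul_const M).mono' (hw.1.smul
    (hφ.smooth.of_le (by simp)).continuous_gradient.aestronglyMeasurable) ?_
  refine Eventually.of_forall fun x => ?_
  rw [norm_smul]
  exact mul_le_mul_of_nonneg_left (hM x) (norm_nonneg _)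

theorem IsTestFunction.integrableOn_smul {φ : EuclideanSpace ℝ (Fin N) → ℝ}
    (hφ : IsTestFunction Ω φ) (hG : IntegrableOn G Ω) :
    IntegrableOn (fun x => φ x • G x) Ω := by
  obtain ⟨M, hM⟩ := hφ.exists_bound
  refine (hG.norm.const_mul M).mono' (hφ.smooth.continuous.aestronglyMeasurable.smul hG.1) ?_
  refine Eventually.of_forall fun x => ?_
  rw [norm_smul]
  exact mul_le_mul_of_nonneg_right (hM x) (norm_nonneg _)

theorem IsWeakGradient.sub {v : EuclideanSpace ℝ (Fin N) → ℝ}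
    {V : EuclideanSpace ℝ (Fin N) → EuclideanSpace ℝ (Fin N)} (hw : IsWeakGradient Ω w G)
    (hv : IsWeakGradient Ω v V) (hwi : IntegrableOn w Ω) (hvi : IntegrableOn v Ω)
    (hGi : IntegrableOn G Ω) (hVi : IntegrableOn V Ω) :
    IsWeakGradient Ω (fun x => w x - v x) (fun x => G x - V x) where
  locallyIntegrable := hw.locallyIntegrable.sub hv.locallyIntegrable
  locallyIntegrable_grad := hw.locallyIntegrable_grad.sub hv.locallyIntegrable_grad
  integral_eq φ hφ := by
    simp only [sub_smul, smul_sub]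
    rw [integral_sub (hφ.integrableOn_smul_gradient hwi) (hφ.integrableOn_smul_gradient hvi),
      integral_sub (hφ.integrableOn_smul hGi) (hφ.integrableOn_smul hVi),
      hw.integral_eq φ hφ, hv.integral_eq φ hφ]
    abel

/-- The chain rule for weak gradients. -/
theorem IsWeakGradient.integral_comp_smul_gradient (hw : IsWeakGradient Ω w G) (hΩ : IsOpen Ω)
    (hwi : IntegrableOn w Ω) (hGi : IntegrableOn G Ω) {T : ℝ → ℝ} (hT : ContDiff ℝ ∞ T)
    {M : ℝ} (hTM : ∀ s, |T s| ≤ M) (hTM' : ∀ s, |deriv T s| ≤ M)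
    {φ : EuclideanSpace ℝ (Fin N) → ℝ} (hφ : IsTestFunction Ω φ) :
    ∫ x in Ω, T (w x) • (∇ φ) x = - ∫ x in Ω, φ x • (deriv T (w x) • G x) := by
  set K := tsupport φ with hK
  have hKc : IsCompact K := hφ.hasCompactSupport
  have hKΩ : K ⊆ Ω := hφ.tsupport_subset
  have hGi' : MemLp G (ENNReal.ofReal 1) (volume.restrict Ω) := by
    rw [ENNReal.ofReal_one]; exact memLp_one_iff_integrable.2 hGi
  have hGK : MemLp G (ENNReal.ofReal 1) (volume.restrict K) := hGi'.mono_measure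
    (Measure.restrict_mono hKΩ le_rfl)
  have hwK : IntegrableOn w K := hwi.mono_set hKΩ
  -- Classical integration by parts holds for `T ∘ z n`. It passes to the limit along an a.e.
  -- convergent subsequence because `T` and its derivative are bounded and the gradients converge in
  -- $L^1$ on the support of `φ`.
  obtain ⟨z₀, hz₀, -, hzl₀, hzg₀⟩ := hw.exists_contDiff_tendsto hΩ le_rfl hwi hGi' hKc hKΩ
  obtain ⟨ns, hns, hae⟩ := (tendstoInMeasure_of_tendsto_eLpNorm one_ne_zero
    (fun n => (hz₀ n).continuous.aestronglyMeasurable) hwK.1 hzl₀).exists_seq_tendsto_ae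
  set z := fun n => z₀ (ns n) with hzdef
  have hz : ∀ n, ContDiff ℝ ∞ (z n) := fun n => hz₀ _
  have hzg := hzg₀.comp hns.tendsto_atTop
  obtain ⟨M₁, hM₁⟩ := hφ.exists_gradient_bound
  obtain ⟨M₂, hM₂⟩ := hφ.exists_bound
  have hT1 : ContDiff ℝ 1 T := hT.of_le (by simp)
  have hdT : Continuous (deriv T) := hT1.continuous_deriv le_rfl
  have hφ1 : ContDiff ℝ 1 φ := hφ.smooth.of_le (by simp)
  have hgφ := hφ1.continuous_gradient
  have hset : ∀ f : EuclideanSpace ℝ (Fin N) → EuclideanSpace ℝ (Fin N), (∀ x ∉ K, f x = 0) →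
      ∫ x in Ω, f x = ∫ x in K, f x := fun f hf => by
    rw [setIntegral_eq_integral_of_forall_compl_eq_zero hf,
      setIntegral_eq_integral_of_forall_compl_eq_zero fun x hx => hf x fun h => hx (hKΩ h)]
  have hfin : IsFiniteMeasure (volume.restrict K) :=
    isFiniteMeasure_restrict.2 hKc.measure_lt_top.ne
  have hgrad : ∀ n x, (∇ (T ∘ z n)) x = deriv T (z n x) • (∇ (z n)) x := by
    intro n x
    have h1 := ((hT1.differentiable one_ne_zero (z n x)).hasDerivAt.comp_hasFDerivAt x
      ((hz n).differentiable (by simp) x).hasFDerivAt)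
    refine (h1.hasGradientAt_of_toDual_eq ?_).gradient
    rw [map_smul, toDual_gradient]
  have hzgc : ∀ n, Continuous (∇ (z n)) := fun n => ((hz n).of_le (by simp)).continuous_gradient
  have hparts : ∀ n, ∫ x in K, T (z n x) • (∇ φ) x
      = - ∫ x in K, (φ x * deriv T (z n x)) • (∇ (z n)) x := by
    intro n
    have h := integral_smul_gradient_eq_neg (hT1.comp ((hz n).of_le (by simp))) hφ1
      hφ.hasCompactSupport
    rw [setIntegral_eq_integral_of_forall_compl_eq_zero fun x hx => by
        rw [gradient_eq_zero_of_notMem_tsupport hx, smul_zero],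
      setIntegral_eq_integral_of_forall_compl_eq_zero fun x hx => by
        rw [image_eq_zero_of_notMem_tsupport hx, zero_mul, zero_smul]]
    simp only [hgrad, smul_smul] at h
    exact h
  have hlim1 : Tendsto (fun n => ∫ x in K, T (z n x) • (∇ φ) x) atTop
      (𝓝 (∫ x in K, T (w x) • (∇ φ) x)) := by
    refine tendsto_integral_of_dominated_convergence (fun _ => M * M₁) (fun n => ?_)
      (integrable_const _) (fun n => Eventually.of_forall fun x => ?_) ?_
    · exact ((hT.continuous.comp (hz n).continuous).smul hgφ).aestronglyMeasurable
    · rw [norm_smul]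
      exact mul_le_mul (hTM _) (hM₁ x) (norm_nonneg _) ((abs_nonneg _).trans (hTM 0))
    · filter_upwards [hae] with x hx
      exact ((hT.continuous.tendsto _).comp hx).smul_const _
  have hlim2 : Tendsto (fun n => ∫ x in K, (φ x * deriv T (z n x)) • (∇ (z n)) x) atTop
      (𝓝 (∫ x in K, (φ x * deriv T (w x)) • G x)) := by
    have hconv : Tendsto (fun n => eLpNorm (fun x => (φ x * deriv T (z n x)) • (∇ (z n)) x
        - (φ x * deriv T (w x)) • G x) (ENNReal.ofReal 1) (volume.restrict K)) atTop (𝓝 0) := by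
      refine tendsto_eLpNorm_smul_sub_smul le_rfl (M := M₂ * M) (fun n => ?_)
        (fun n => Eventually.of_forall fun x => ?_) ?_ (fun n => ?_) hGK hzg
      · exact (hφ1.continuous.mul (hdT.comp (hz n).continuous)).aestronglyMeasurable
      · rw [abs_mul]
        exact mul_le_mul (hM₂ x) (hTM' _) (abs_nonneg _) ((norm_nonneg _).trans (hM₂ 0))
      · filter_upwards [hae] with x hx
        exact ((hdT.tendsto _).comp hx).const_mul _
      · exact (hzgc n).aestronglyMeasurable
    rw [ENNReal.ofReal_one] at hconv
    refine tendsto_integral_of_L1' _ ?_ (Eventually.of_forall fun n => ?_) hconv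
    · exact (hφ1.continuous.aestronglyMeasurable.mul
        (hdT.comp_aestronglyMeasurable hwK.1)).smul hGK.1
    · exact ((hφ1.continuous.mul (hdT.comp (hz n).continuous)).smul
        (hzgc n)).continuousOn.integrableOn_compact hKc
  have e1 : ∫ x in Ω, T (w x) • (∇ φ) x = ∫ x in K, T (w x) • (∇ φ) x :=
    hset _ fun x hx => by rw [gradient_eq_zero_of_notMem_tsupport hx, smul_zero]
  have e2 : ∫ x in Ω, φ x • (deriv T (w x) • G x) = ∫ x in K, (φ x * deriv T (w x)) • G x := by
    rw [hset _ fun x hx => by rw [image_eq_zero_of_notMem_tsupport hx, zero_smul]]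
    exact integral_congr_ae (Eventually.of_forall fun x => smul_smul _ _ _)
  rw [e1, e2]
  exact tendsto_nhds_unique hlim1 (hlim2.neg.congr fun n => (hparts n).symm)

/-- `expNegInvGlue` is the nonlinearity in the chain rule below: smooth, bounded with bounded
derivative, zero on the negative axis, and with positive derivative on the positive axis. -/
theorem expNegInvGlue_le_one (s : ℝ) : expNegInvGlue s ≤ 1 := by
  rcases le_or_gt s 0 with h | h
  · rw [expNegInvGlue.zero_of_nonpos h]; exact zero_le_one
  · rw [expNegInvGlue, if_neg h.not_ge]
    exact Real.exp_le_one_iff.2 (by simpa using h.le)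

theorem hasDerivAt_expNegInvGlue_of_pos {s : ℝ} (hs : 0 < s) :
    HasDerivAt expNegInvGlue (Real.exp (-s⁻¹) * (s ^ 2)⁻¹) s := by
  have h := (hasDerivAt_inv hs.ne').neg.exp
  have heq : expNegInvGlue =ᶠ[𝓝 s] fun x => Real.exp (-x⁻¹) := by
    filter_upwards [lt_mem_nhds hs] with x hx
    rw [expNegInvGlue, if_neg hx.not_ge]
  exact (h.congr_of_eventuallyEq heq).congr_deriv (by simp)

theorem deriv_expNegInvGlue_of_nonpos {s : ℝ} (hs : s ≤ 0) : deriv expNegInvGlue s = 0 := by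
  have : IsLocalMin expNegInvGlue s := Eventually.of_forall fun x => by
    rw [expNegInvGlue.zero_of_nonpos hs]; exact expNegInvGlue.nonneg x
  exact this.deriv_eq_zero

theorem abs_deriv_expNegInvGlue_le (s : ℝ) : |deriv expNegInvGlue s| ≤ 2 := by
  rcases le_or_gt s 0 with h | h
  · rw [deriv_expNegInvGlue_of_nonpos h]; norm_num
  · rw [(hasDerivAt_expNegInvGlue_of_pos h).deriv, abs_of_nonneg (by positivity), Real.exp_neg,
      ← inv_pow, inv_mul_le_iff₀ (Real.exp_pos _)]
    -- With $y=1/s$ the claim is $y^2\le 2e^y$, which follows from $1+y+y^2/2\le e^y$.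
    have := Real.quadratic_le_exp_of_nonneg (inv_nonneg.2 h.le)
    have h' := inv_pos.2 h
    linarith

/-- Any weak gradient of the positive part of `z` coincides with that of `z` where `z > 0`. -/
theorem IsWeakGradient.ae_eq_of_posPart {z : EuclideanSpace ℝ (Fin N) → ℝ}
    {H : EuclideanSpace ℝ (Fin N) → EuclideanSpace ℝ (Fin N)} (hΩ : IsOpen Ω)
    (hz : IsWeakGradient Ω z H) (hw : IsWeakGradient Ω (fun x => max (z x) 0) G)
    (hzi : IntegrableOn z Ω) (hHi : IntegrableOn H Ω) (hGi : IntegrableOn G Ω) :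
    ∀ᵐ x ∂(volume.restrict Ω), 0 < z x → G x = H x := by
  have hT : ContDiff ℝ ∞ expNegInvGlue := expNegInvGlue.contDiff
  have hdT : Continuous (deriv expNegInvGlue) :=
    (hT.of_le (by simp) : ContDiff ℝ 1 expNegInvGlue).continuous_deriv le_rfl
  have hb : ∀ s, |expNegInvGlue s| ≤ 2 := fun s => by
    rw [abs_of_nonneg (expNegInvGlue.nonneg s)]
    exact (expNegInvGlue_le_one s).trans one_le_two
  have hwi : IntegrableOn (fun x => max (z x) 0) Ω := hzi.pos_part
  -- Neither `expNegInvGlue` nor its derivative distinguishes `s` from `max s 0`. The chain rules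
  -- for `z` and for its positive part therefore have the same left side, so `G` and `H` agree
  -- wherever the derivative is nonzero.
  have hTw : ∀ s, expNegInvGlue (max s 0) = expNegInvGlue s := fun s => by
    rcases le_or_gt s 0 with h | h
    · rw [max_eq_right h, expNegInvGlue.zero_of_nonpos h, expNegInvGlue.zero]
    · rw [max_eq_left h.le]
  have hTw' : ∀ s, deriv expNegInvGlue (max s 0) = deriv expNegInvGlue s := fun s => by
    rcases le_or_gt s 0 with h | h
    · rw [max_eq_right h, deriv_expNegInvGlue_of_nonpos h, deriv_expNegInvGlue_of_nonpos le_rfl]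
    · rw [max_eq_left h.le]
  have hbd : ∀ {A : EuclideanSpace ℝ (Fin N) → EuclideanSpace ℝ (Fin N)}, IntegrableOn A Ω →
      IntegrableOn (fun x => deriv expNegInvGlue (z x) • A x) Ω := fun hA =>
    hA.bdd_smul 2 (hdT.comp_aestronglyMeasurable hzi.1)
      (Eventually.of_forall fun x => abs_deriv_expNegInvGlue_le _)
  have key : ∀ᵐ x, x ∈ Ω → deriv expNegInvGlue (z x) • G x - deriv expNegInvGlue (z x) • H x = 0 := by
    refine hΩ.ae_eq_zero_of_integral_contDiff_smul_eq_zero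
      ((hbd hGi).sub (hbd hHi)).locallyIntegrableOn fun φ h1 h2 h3 => ?_
    have hφ : IsTestFunction Ω φ := ⟨h1, h2, h3⟩
    have e1 := hz.integral_comp_smul_gradient hΩ hzi hHi hT hb abs_deriv_expNegInvGlue_le hφ
    have e2 := hw.integral_comp_smul_gradient hΩ hwi hGi hT hb abs_deriv_expNegInvGlue_le hφ
    simp only [hTw, hTw'] at e2
    rw [← setIntegral_eq_integral_of_forall_compl_eq_zero (s := Ω) fun x hx => by
      rw [image_eq_zero_of_notMem_tsupport fun h => hx (h3 h), zero_smul]]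
    simp only [smul_sub]
    rw [integral_sub (hφ.integrableOn_smul (hbd hGi)) (hφ.integrableOn_smul (hbd hHi)), sub_eq_zero]
    rw [e1] at e2
    exact (neg_inj.1 e2).symm
  rw [ae_restrict_iff' hΩ.measurableSet]
  filter_upwards [key] with x hx hxΩ hpos
  have h := hx hxΩ
  rw [← smul_sub, smul_eq_zero, (hasDerivAt_expNegInvGlue_of_pos hpos).deriv] at h
  rcases h with h | h
  · have : 0 < Real.exp (-(z x)⁻¹) * ((z x) ^ 2)⁻¹ := by positivity
    exact absurd h this.ne'
  · exact sub_eq_zero.1 h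

end ChainRule

/-! ### Nonlinear test functions as limits of smooth ones. -/

section Approximation

variable {N : ℕ} {Ω : Set (EuclideanSpace ℝ (Fin N))}

/-- The point stays in the half plane where `F` is smooth only over the support of `ψ`. Elsewhere it
lies on the diagonal, where `F` vanishes. -/
theorem ContDiff.comp_pair_of_eventually_zero {F : ℝ × ℝ → ℝ} {c : ℝ} (hc : 0 < c)
    (hF : ContDiffOn ℝ ∞ F {q | 0 < q.1}) (hF0 : ∀ b, F (b, b) = 0)
    {z ψ : EuclideanSpace ℝ (Fin N) → ℝ} (hz : ContDiff ℝ ∞ z) (hψ : ContDiff ℝ ∞ ψ)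
    (hzc : ∀ x ∈ tsupport ψ, c ≤ z x) : ContDiff ℝ ∞ fun x => F (z x, z x + ψ x) := by
  rw [contDiff_iff_contDiffAt]
  intro x
  by_cases hx : x ∈ tsupport ψ
  · have h1 : ContDiffAt ℝ ∞ F (z x, z x + ψ x) :=
      hF.contDiffAt ((isOpen_lt continuous_const continuous_fst).mem_nhds
        (hc.trans_le (hzc x hx)))
    exact h1.comp x (hz.contDiffAt.prodMk (hz.contDiffAt.add hψ.contDiffAt))
  · have h0 : (fun x => F (z x, z x + ψ x)) =ᶠ[𝓝 x] fun _ => 0 := by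
      filter_upwards [notMem_tsupport_iff_eventuallyEq.1 hx] with y hy
      rw [hy, Pi.zero_apply, add_zero, hF0]
    exact contDiffAt_const.congr_of_eventuallyEq h0

theorem tsupport_comp_pair_subset {F : ℝ × ℝ → ℝ} (hF0 : ∀ b, F (b, b) = 0)
    {z ψ : EuclideanSpace ℝ (Fin N) → ℝ} :
    tsupport (fun x => F (z x, z x + ψ x)) ⊆ tsupport ψ := by
  refine closure_mono fun x hx => ?_
  contrapose! hx
  simp [Function.notMem_support.1 hx, hF0]

theorem gradient_comp_pair {F : ℝ × ℝ → ℝ} {z ψ : EuclideanSpace ℝ (Fin N) → ℝ}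
    {x : EuclideanSpace ℝ (Fin N)} (hF : DifferentiableAt ℝ F (z x, z x + ψ x))
    (hz : DifferentiableAt ℝ z x) (hψ : DifferentiableAt ℝ ψ x) :
    (∇ fun x => F (z x, z x + ψ x)) x = fderiv ℝ F (z x, z x + ψ x) (1, 0) • (∇ z) x
      + fderiv ℝ F (z x, z x + ψ x) (0, 1) • ((∇ z) x + (∇ ψ) x) := by
  have h := hF.hasFDerivAt.comp x (hz.hasFDerivAt.prodMk (hz.hasFDerivAt.add hψ.hasFDerivAt))
  refine (h.hasGradientAt_of_toDual_eq ?_).gradient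
  rw [map_add, map_smul, map_smul, map_add, toDual_gradient, toDual_gradient]
  ext y
  have : ((fderiv ℝ z x) y, (fderiv ℝ z x) y + (fderiv ℝ ψ x) y)
      = (fderiv ℝ z x) y • ((1 : ℝ), (0 : ℝ))
        + ((fderiv ℝ z x) y + (fderiv ℝ ψ x) y) • ((0 : ℝ), (1 : ℝ)) := by
    ext <;> simp
  simp only [add_apply, smul_apply,
    ContinuousLinearMap.comp_apply, ContinuousLinearMap.prod_apply, smul_eq_mul]
  rw [this, map_add, map_smul, map_smul, smul_eq_mul, smul_eq_mul]
  ring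

/-- A zero of a nonnegative function is a minimum. For the profiles this kills the derivative on the
diagonal, that is, where $u\le v$. -/
theorem fderiv_eq_zero_of_nonneg {F : ℝ × ℝ → ℝ} (hFn : ∀ q : ℝ × ℝ, 0 < q.1 → 0 ≤ F q)
    {q : ℝ × ℝ} (hq : 0 < q.1) (hq0 : F q = 0) : fderiv ℝ F q = 0 := by
  have : IsLocalMin F q := by
    filter_upwards [(isOpen_lt continuous_const continuous_fst).mem_nhds hq] with y hy
    rw [hq0]
    exact hFn y hy
  exact this.fderiv_eq_zero

/-- Nonlinear functions of a weakly differentiable function `v` that is bounded below and of a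
function `w` of `W₀^{1,p}(Ω)` are limits of bounded nonnegative test functions if they vanish for
`w = 0`. -/
theorem exists_isTestFunction_tendsto (hΩ : IsOpen Ω) {p : ℝ} (hp : 1 ≤ p)
    {v w : EuclideanSpace ℝ (Fin N) → ℝ} {V G : EuclideanSpace ℝ (Fin N) → EuclideanSpace ℝ (Fin N)}
    (hv : IsWeakGradient Ω v V) (hvi : IntegrableOn v Ω)
    (hV : MemLp V (ENNReal.ofReal p) (volume.restrict Ω)) {c : ℝ} (hc : 0 < c)
    (hcv : ∀ᵐ x ∂(volume.restrict Ω), c ≤ v x)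
    (hw : AEStronglyMeasurable w (volume.restrict Ω))
    (hG : MemLp G (ENNReal.ofReal p) (volume.restrict Ω))
    {ψ : ℕ → EuclideanSpace ℝ (Fin N) → ℝ} (hψ : ∀ n, IsTestFunction Ω (ψ n))
    (hψw : Tendsto (fun n => eLpNorm (fun x => ψ n x - w x) (ENNReal.ofReal p)
      (volume.restrict Ω)) atTop (𝓝 0))
    (hψG : Tendsto (fun n => eLpNorm (fun x => (∇ (ψ n)) x - G x) (ENNReal.ofReal p)
      (volume.restrict Ω)) atTop (𝓝 0))
    {F : ℝ × ℝ → ℝ} (hF : ContDiffOn ℝ ∞ F {q | 0 < q.1}) (hF0 : ∀ b, F (b, b) = 0)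
    (hFn : ∀ q : ℝ × ℝ, 0 < q.1 → 0 ≤ F q) {M : ℝ}
    (hFM : ∀ q : ℝ × ℝ, c ≤ q.1 → F q ≤ M)
    (hFM₁ : ∀ q : ℝ × ℝ, c ≤ q.1 → |fderiv ℝ F q (1, 0)| ≤ M)
    (hFM₂ : ∀ q : ℝ × ℝ, c ≤ q.1 → |fderiv ℝ F q (0, 1)| ≤ M) :
    ∃ φ : ℕ → EuclideanSpace ℝ (Fin N) → ℝ, (∀ n, IsTestFunction Ω (φ n)) ∧
      (∀ n x, 0 ≤ φ n x) ∧ (∀ n x, φ n x ≤ M) ∧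
      (∀ᵐ x ∂(volume.restrict Ω), Tendsto (fun n => φ n x) atTop (𝓝 (F (v x, v x + w x)))) ∧
      MemLp (fun x => fderiv ℝ F (v x, v x + w x) (1, 0) • V x
          + fderiv ℝ F (v x, v x + w x) (0, 1) • (V x + G x)) (ENNReal.ofReal p)
        (volume.restrict Ω) ∧
      Tendsto (fun n => eLpNorm (fun x => (∇ (φ n)) x -
        (fderiv ℝ F (v x, v x + w x) (1, 0) • V x
          + fderiv ℝ F (v x, v x + w x) (0, 1) • (V x + G x))) (ENNReal.ofReal p)
        (volume.restrict Ω)) atTop (𝓝 0) := by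
  have hp1 : 1 ≤ ENNReal.ofReal p := by simpa using ENNReal.ofReal_le_ofReal hp
  have hp0 : ENNReal.ofReal p ≠ 0 := (zero_lt_one.trans_le hp1).ne'
  have hopen : IsOpen {q : ℝ × ℝ | 0 < q.1} := isOpen_lt continuous_const continuous_fst
  have hKm : ∀ n, MeasurableSet (tsupport (ψ n)) := fun n => (isClosed_tsupport _).measurableSet
  -- smooth approximations of `v` on the supports
  have hex : ∀ n, ∃ z : EuclideanSpace ℝ (Fin N) → ℝ, ContDiff ℝ ∞ z ∧
      (∀ x ∈ tsupport (ψ n), c ≤ z x) ∧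
      eLpNorm (fun x => z x - v x) 1 (volume.restrict (tsupport (ψ n)))
        ≤ ENNReal.ofReal (1 / ((n : ℝ) + 1)) ∧
      eLpNorm (fun x => (∇ z) x - V x) (ENNReal.ofReal p) (volume.restrict (tsupport (ψ n)))
        ≤ ENNReal.ofReal (1 / ((n : ℝ) + 1)) := by
    intro n
    obtain ⟨z, h1, h2, h3, h4⟩ := hv.exists_contDiff_tendsto hΩ hp hvi hV
      (hψ n).hasCompactSupport (hψ n).tsupport_subset
    have hpos : (0 : ENNReal) < ENNReal.ofReal (1 / ((n : ℝ) + 1)) :=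
      ENNReal.ofReal_pos.2 (by positivity)
    obtain ⟨k, hk1, hk2⟩ := ((h3.eventually (gt_mem_nhds hpos)).and
      (h4.eventually (gt_mem_nhds hpos))).exists
    exact ⟨z k, h1 k, h2 c hcv k, hk1.le, hk2.le⟩
  choose z hz hzc hzv hzV using hex
  -- The approximation errors are extended by zero off the support of `ψ n`. Then `v + X n` is `z n`
  -- on the support and `v` off it, so that formulas in `q` below hold on all of `Ω`, although `z n`
  -- is controlled only on the support.
  set X : ℕ → EuclideanSpace ℝ (Fin N) → ℝ := fun n =>
    (tsupport (ψ n)).indicator fun x => z n x - v x with hX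
  set Y : ℕ → EuclideanSpace ℝ (Fin N) → EuclideanSpace ℝ (Fin N) := fun n =>
    (tsupport (ψ n)).indicator fun x => (∇ (z n)) x - V x with hY
  have hlim0 : Tendsto (fun n : ℕ => ENNReal.ofReal (1 / ((n : ℝ) + 1))) atTop (𝓝 0) := by
    simpa using ENNReal.tendsto_ofReal (tendsto_one_div_add_atTop_nhds_zero_nat (𝕜 := ℝ))
  have hgz : ∀ n, Continuous (∇ (z n)) := fun n => ((hz n).of_le (by simp)).continuous_gradient
  have hgψ : ∀ n, Continuous (∇ (ψ n)) := fun n =>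
    ((hψ n).smooth.of_le (by simp)).continuous_gradient
  have hXm : ∀ n, AEStronglyMeasurable (X n) (volume.restrict Ω) := fun n =>
    ((hz n).continuous.aestronglyMeasurable.sub hvi.1).indicator (hKm n)
  have hYm : ∀ n, AEStronglyMeasurable (Y n) (volume.restrict Ω) := fun n =>
    ((hgz n).aestronglyMeasurable.sub hV.1).indicator (hKm n)
  have hres : ∀ n, (volume.restrict Ω).restrict (tsupport (ψ n))
      = volume.restrict (tsupport (ψ n)) := fun n => by
    rw [Measure.restrict_restrict (hKm n), Set.inter_eq_left.2 (hψ n).tsupport_subset]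
  have hXlim : Tendsto (fun n => eLpNorm (X n - 0) 1 (volume.restrict Ω)) atTop (𝓝 0) := by
    refine tendsto_of_tendsto_of_tendsto_of_le_of_le tendsto_const_nhds hlim0
      (fun _ => zero_le) fun n => ?_
    rw [sub_zero, hX]
    beta_reduce
    rw [eLpNorm_indicator_eq_eLpNorm_restrict (hKm n), hres n]
    exact hzv n
  have hYlim : Tendsto (fun n => eLpNorm (Y n) (ENNReal.ofReal p) (volume.restrict Ω))
      atTop (𝓝 0) := by
    refine tendsto_of_tendsto_of_tendsto_of_le_of_le tendsto_const_nhds hlim0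
      (fun _ => zero_le) fun n => ?_
    rw [hY]
    beta_reduce
    rw [eLpNorm_indicator_eq_eLpNorm_restrict (hKm n), hres n]
    exact hzV n
  -- a subsequence that converges almost everywhere
  obtain ⟨ns, hns, hXae⟩ := (tendstoInMeasure_of_tendsto_eLpNorm one_ne_zero hXm
    aestronglyMeasurable_const hXlim).exists_seq_tendsto_ae
  obtain ⟨ms, hms, hψae⟩ := (tendstoInMeasure_of_tendsto_eLpNorm hp0
    (fun n => (hψ (ns n)).smooth.continuous.aestronglyMeasurable) hw
    (hψw.comp hns.tendsto_atTop)).exists_seq_tendsto_ae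
  set ks : ℕ → ℕ := fun n => ns (ms n) with hks
  have hkst : Tendsto ks atTop atTop := hns.tendsto_atTop.comp hms.tendsto_atTop
  set φ : ℕ → EuclideanSpace ℝ (Fin N) → ℝ := fun n x =>
    F (z (ks n) x, z (ks n) x + ψ (ks n) x) with hφ
  set q : ℕ → EuclideanSpace ℝ (Fin N) → ℝ × ℝ := fun n x =>
    (v x + X (ks n) x, v x + X (ks n) x + ψ (ks n) x) with hq
  have hq_in : ∀ n, ∀ x ∈ tsupport (ψ (ks n)),
      q n x = (z (ks n) x, z (ks n) x + ψ (ks n) x) := by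
    intro n x hx
    simp only [hq, hX, Set.indicator_of_mem hx, add_sub_cancel]
  have hq_out : ∀ n, ∀ x ∉ tsupport (ψ (ks n)), q n x = (v x, v x) := by
    intro n x hx
    simp only [hq, hX, Set.indicator_of_notMem hx, image_eq_zero_of_notMem_tsupport hx, add_zero]
  have hqc : ∀ᵐ x ∂(volume.restrict Ω), ∀ n, c ≤ (q n x).1 := by
    filter_upwards [hcv] with x hx n
    by_cases hxK : x ∈ tsupport (ψ (ks n))
    · rw [hq_in n x hxK]; exact hzc _ x hxK
    · rw [hq_out n x hxK]; exact hx
  have hqm : ∀ n, AEMeasurable (q n) (volume.restrict Ω) := by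
    intro n
    have h1 := (hvi.1.add (hXm (ks n))).aemeasurable
    exact h1.prodMk (h1.add (hψ (ks n)).smooth.continuous.aemeasurable)
  have hqlim : ∀ᵐ x ∂(volume.restrict Ω),
      Tendsto (fun n => q n x) atTop (𝓝 (v x, v x + w x)) := by
    filter_upwards [hXae, hψae] with x h1 h2
    have h1' : Tendsto (fun n => v x + X (ks n) x) atTop (𝓝 (v x)) := by
      have h0 : Tendsto (fun n => X (ks n) x) atTop (𝓝 0) := h1.comp hms.tendsto_atTop
      simpa using h0.const_add (v x)
    exact h1'.prodMk_nhds (h1'.add h2)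
  have hφq : ∀ n x, φ n x = F (q n x) := by
    intro n x
    by_cases hxK : x ∈ tsupport (ψ (ks n))
    · rw [hq_in n x hxK]
    · rw [hq_out n x hxK, hF0]
      simp only [hφ, image_eq_zero_of_notMem_tsupport hxK, add_zero, hF0]
  -- Off the support both sides vanish: `φ n` is locally zero there, and the derivative of `F` is
  -- zero on the diagonal.
  have hgrad : ∀ᵐ x ∂(volume.restrict Ω), ∀ n, (∇ (φ n)) x
      = fderiv ℝ F (q n x) (1, 0) • (V x + Y (ks n) x)
        + fderiv ℝ F (q n x) (0, 1) • (V x + Y (ks n) x + (∇ (ψ (ks n))) x) := by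
    filter_upwards [hcv] with x hx n
    by_cases hxK : x ∈ tsupport (ψ (ks n))
    · have hd : DifferentiableAt ℝ F (z (ks n) x, z (ks n) x + ψ (ks n) x) :=
        (hF.contDiffAt (hopen.mem_nhds (hc.trans_le (hzc _ x hxK)))).differentiableAt (by simp)
      rw [hφ]
      beta_reduce
      rw [gradient_comp_pair hd ((hz _).differentiable (by simp) x)
        ((hψ _).smooth.differentiable (by simp) x), hq_in n x hxK]
      simp only [hY, Set.indicator_of_mem hxK, add_sub_cancel]
    · rw [hq_out n x hxK, fderiv_eq_zero_of_nonneg hFn (hc.trans_le hx) (hF0 _),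
        gradient_eq_zero_of_notMem_tsupport fun h => hxK (tsupport_comp_pair_subset hF0 h)]
      simp
  have hcont : ∀ e : ℝ × ℝ, ∀ᵐ x ∂(volume.restrict Ω),
      Tendsto (fun n => fderiv ℝ F (q n x) e) atTop (𝓝 (fderiv ℝ F (v x, v x + w x) e)) := by
    intro e
    have hcf : ContinuousOn (fderiv ℝ F) {q : ℝ × ℝ | 0 < q.1} :=
      hF.continuousOn_fderiv_of_isOpen hopen (by simp)
    filter_upwards [hqlim, hcv] with x h1 h2
    have h3 := (hcf.continuousAt (hopen.mem_nhds (x := (v x, v x + w x)) (hc.trans_le h2))).tendsto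
    exact ((ContinuousLinearMap.apply ℝ ℝ e).continuous.tendsto _).comp (h3.comp h1)
  have hcm : ∀ e : ℝ × ℝ, ∀ n,
      AEStronglyMeasurable (fun x => fderiv ℝ F (q n x) e) (volume.restrict Ω) := fun e n =>
    ((measurable_fderiv_apply_const ℝ F e).comp_aemeasurable (hqm n)).aestronglyMeasurable
  have hl : ∀ e, AEStronglyMeasurable (fun x => fderiv ℝ F (v x, v x + w x) e)
      (volume.restrict Ω) := fun e => aestronglyMeasurable_of_tendsto_ae atTop (hcm e) (hcont e)
  have hM0 : 0 ≤ M := by simpa [hF0] using hFM (c, c) le_rfl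
  refine ⟨φ, fun n => ⟨?_, ?_, ?_⟩, fun n x => ?_, fun n x => ?_, ?_, ?_,
    ?_⟩
  · exact ContDiff.comp_pair_of_eventually_zero hc hF hF0 (hz _) (hψ _).smooth (hzc _)
  · exact (hψ (ks n)).hasCompactSupport.of_isClosed_subset (isClosed_tsupport _)
      (tsupport_comp_pair_subset hF0)
  · exact (tsupport_comp_pair_subset hF0).trans (hψ (ks n)).tsupport_subset
  · by_cases hxK : x ∈ tsupport (ψ (ks n))
    · exact hFn _ (hc.trans_le (hzc _ x hxK))
    · simp only [hφ, image_eq_zero_of_notMem_tsupport hxK, add_zero, hF0, le_refl]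
  · by_cases hxK : x ∈ tsupport (ψ (ks n))
    · exact hFM _ (hzc _ x hxK)
    · simpa only [hφ, image_eq_zero_of_notMem_tsupport hxK, add_zero, hF0] using hM0
  · filter_upwards [hqlim, hcv] with x h1 h2
    simp only [hφq]
    exact ((hF.contDiffAt (hopen.mem_nhds (x := (v x, v x + w x))
      (hc.trans_le h2))).continuousAt.tendsto).comp h1
  · have hbd : ∀ (e : ℝ × ℝ) {A : EuclideanSpace ℝ (Fin N) → EuclideanSpace ℝ (Fin N)},
        (∀ q : ℝ × ℝ, c ≤ q.1 → |fderiv ℝ F q e| ≤ M) →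
        MemLp A (ENNReal.ofReal p) (volume.restrict Ω) →
        MemLp (fun x => fderiv ℝ F (v x, v x + w x) e • A x) (ENNReal.ofReal p)
          (volume.restrict Ω) := by
      intro e A he hA
      refine hA.of_le_mul (c := M) ((hl e).smul hA.1) ?_
      filter_upwards [hcv] with x hx
      rw [norm_smul]
      exact mul_le_mul_of_nonneg_right (he _ hx) (norm_nonneg _)
    exact (hbd _ hFM₁ hV).add (hbd _ hFM₂ (hV.add hG))
  · have hYk := hYlim.comp hkst
    have hψk := hψG.comp hkst
    have hf1 : Tendsto (fun n => eLpNorm (fun x => (V x + Y (ks n) x) - V x) (ENNReal.ofReal p)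
        (volume.restrict Ω)) atTop (𝓝 0) := by
      simp only [add_sub_cancel_left]
      exact hYk
    have hf2 : Tendsto (fun n => eLpNorm (fun x => (V x + Y (ks n) x + (∇ (ψ (ks n))) x)
        - (V x + G x)) (ENNReal.ofReal p) (volume.restrict Ω)) atTop (𝓝 0) := by
      have h := hYk.add hψk
      rw [add_zero] at h
      refine tendsto_of_tendsto_of_tendsto_of_le_of_le tendsto_const_nhds h (fun _ => zero_le)
        fun n => ?_
      refine le_trans (le_of_eq ?_) (eLpNorm_add_le (hYm (ks n))
        ((hgψ (ks n)).aestronglyMeasurable.sub hG.1) hp1)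
      congr 1
      ext1 x
      simp only [Pi.add_apply]
      abel
    have hm1 : ∀ n, AEStronglyMeasurable (fun x => V x + Y (ks n) x) (volume.restrict Ω) :=
      fun n => hV.1.add (hYm _)
    have hm2 : ∀ n, AEStronglyMeasurable (fun x => V x + Y (ks n) x + (∇ (ψ (ks n))) x)
        (volume.restrict Ω) := fun n => (hm1 n).add (hgψ _).aestronglyMeasurable
    have t1 := tendsto_eLpNorm_smul_sub_smul hp (hcm (1, 0)) (M := M)
      (fun n => hqc.mono fun x hx => hFM₁ _ (hx n)) (hcont (1, 0)) hm1 hV hf1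
    have t2 := tendsto_eLpNorm_smul_sub_smul hp (hcm (0, 1)) (M := M)
      (fun n => hqc.mono fun x hx => hFM₂ _ (hx n)) (hcont (0, 1)) hm2 (hV.add hG) hf2
    have t := t1.add t2
    rw [add_zero] at t
    refine tendsto_of_tendsto_of_tendsto_of_le_of_le tendsto_const_nhds t (fun _ => zero_le)
      fun n => ?_
    refine le_trans (le_of_eq ?_) (eLpNorm_add_le (((hcm (1, 0) n).smul (hm1 n)).sub
      ((hl (1, 0)).smul hV.1)) (((hcm (0, 1) n).smul (hm2 n)).sub
      ((hl (0, 1)).smul (hV.1.add hG.1))) hp1)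
    refine eLpNorm_congr_ae ?_
    filter_upwards [hgrad] with x hx
    simp only [hx, Pi.add_apply]
    abel

end Approximation

/-! ### Picone's inequality and its equality case. -/

section Picone

/-- Division by $b^p$ turns this into Bernoulli's inequality for $(a/b)^p$, which is strict unless
$a/b=1$. -/
theorem rpow_picone {p a b : ℝ} (hp : 1 < p) (ha : 0 ≤ a) (hb : 0 ≤ b) :
    0 ≤ a ^ p + (p - 1) * b ^ p - p * (b ^ (p - 1) * a) ∧
      (a ^ p + (p - 1) * b ^ p - p * (b ^ (p - 1) * a) = 0 → a = b) := by
  have hp0 : 0 < p := by linarith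
  rcases hb.eq_or_lt with rfl | hb
  · rw [Real.zero_rpow hp0.ne', Real.zero_rpow (by linarith : p - 1 ≠ 0)]
    simp only [mul_zero, zero_mul, add_zero, sub_zero]
    refine ⟨Real.rpow_nonneg ha p, fun h => ?_⟩
    exact (Real.rpow_eq_zero ha hp0.ne').1 h
  · have hbp : 0 < b ^ p := Real.rpow_pos_of_pos hb p
    have hs : -1 ≤ a / b - 1 := by have := div_nonneg ha hb.le; linarith
    have hid : a ^ p + (p - 1) * b ^ p - p * (b ^ (p - 1) * a)
        = b ^ p * ((1 + (a / b - 1)) ^ p - (1 + p * (a / b - 1))) := by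
      rw [add_sub_cancel, Real.div_rpow ha hb.le, Real.rpow_sub_one hb.ne']
      field_simp
      ring
    rw [hid]
    refine ⟨mul_nonneg hbp.le (sub_nonneg.2 (one_add_mul_self_le_rpow_one_add hs hp.le)),
      fun h => ?_⟩
    by_contra hne
    have hne' : a / b - 1 ≠ 0 := by
      rw [sub_ne_zero, Ne, div_eq_one_iff_eq hb.ne']
      exact hne
    have := one_add_mul_self_lt_rpow_one_add hs hne' hp
    exact (mul_pos hbp (sub_pos.2 this)).ne' h

variable {H : Type*} [NormedAddCommGroup H] [InnerProductSpace ℝ H]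

theorem norm_rpow_sub_two_mul_inner_le (p : ℝ) (x y : H) :
    ‖y‖ ^ (p - 2) * inner ℝ y x ≤ ‖y‖ ^ (p - 1) * ‖x‖ := by
  rcases eq_or_ne y 0 with rfl | hy
  · simp only [inner_zero_left, mul_zero]
    positivity
  · have h : ‖y‖ ^ (p - 1) = ‖y‖ ^ (p - 2) * ‖y‖ := by
      rw [← Real.rpow_add_one (norm_ne_zero_iff.2 hy)]; ring_nf
    rw [h, mul_assoc]
    exact mul_le_mul_of_nonneg_left (real_inner_le_norm y x) (by positivity)

theorem norm_rpow_sub_two_mul_inner_self {p : ℝ} (hp : 1 < p) (x : H) :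
    ‖x‖ ^ (p - 2) * inner ℝ x x = ‖x‖ ^ p := by
  rcases eq_or_ne x 0 with rfl | hx
  · rw [inner_zero_left, mul_zero, norm_zero, Real.zero_rpow (by linarith)]
  · rw [real_inner_self_eq_norm_sq, ← Real.rpow_natCast, ← Real.rpow_add (norm_pos_iff.2 hx)]
    norm_num

/-- The remainder in Picone's inequality. -/
noncomputable def piconeGap (p : ℝ) (x y : H) : ℝ :=
  ‖x‖ ^ p + (p - 1) * ‖y‖ ^ p - p * (‖y‖ ^ (p - 2) * inner ℝ y x)

theorem piconeGap_nonneg {p : ℝ} (hp : 1 < p) (x y : H) : 0 ≤ piconeGap p x y := by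
  have h1 := (rpow_picone hp (norm_nonneg x) (norm_nonneg y)).1
  have h2 := norm_rpow_sub_two_mul_inner_le p x y
  have h3 := mul_le_mul_of_nonneg_left h2 (by linarith : (0 : ℝ) ≤ p)
  unfold piconeGap
  linarith

/-- The gap is the sum of a Young gap for the norms and a Cauchy–Schwarz gap. The first forces equal
norms; the second then gives $\langle y,x\rangle=|y|^2$, hence $|x-y|^2=0$. -/
theorem eq_of_piconeGap_eq_zero {p : ℝ} (hp : 1 < p) {x y : H} (h : piconeGap p x y = 0) :
    x = y := by
  have h1 := rpow_picone hp (norm_nonneg x) (norm_nonneg y)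
  have h2 := norm_rpow_sub_two_mul_inner_le p x y
  have h3 := mul_le_mul_of_nonneg_left h2 (by linarith : (0 : ℝ) ≤ p)
  unfold piconeGap at h
  have hn : ‖x‖ = ‖y‖ := h1.2 (by linarith [h1.1])
  rcases eq_or_ne y 0 with rfl | hy
  · rwa [norm_zero, norm_eq_zero] at hn
  · have hy' : 0 < ‖y‖ ^ (p - 2) := Real.rpow_pos_of_pos (norm_pos_iff.2 hy) _
    have e : ‖y‖ ^ (p - 2) * inner ℝ y x = ‖y‖ ^ p := by
      rw [hn] at h
      have hp0 : p ≠ 0 := by linarith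
      have : p * (‖y‖ ^ p - ‖y‖ ^ (p - 2) * inner ℝ y x) = 0 := by linarith
      have := (mul_eq_zero.1 this).resolve_left hp0
      linarith
    rw [← norm_rpow_sub_two_mul_inner_self hp y] at e
    have e' : inner ℝ y x = inner ℝ y y := mul_left_cancel₀ hy'.ne' e
    have : ‖x - y‖ ^ 2 = 0 := by
      rw [norm_sub_sq_real, hn, real_inner_comm, e', real_inner_self_eq_norm_sq]
      ring
    exact sub_eq_zero.1 (norm_eq_zero.1 (pow_eq_zero_iff two_ne_zero |>.1 this))

/-- The pointwise inequality behind the comparison principle; `x` and `y` are the logarithmic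
gradients. -/
theorem le_picone_combination {p : ℝ} (hp : 1 < p) (x y : H) {l s k : ℝ} (hl1 : l ≤ 1)
    (hs : 0 ≤ s) (hs1 : s ≤ 1) (hk : 0 ≤ k) :
    l * s * piconeGap p x y - (1 - l) * (p - 1) * ‖x‖ ^ p ≤
      ((1 - p + p * l) * s + k) * ‖x‖ ^ p - k * (‖x‖ ^ (p - 2) * inner ℝ x y)
        - ((1 - p) * s - k) * ‖y‖ ^ p - (p * l * s + k) * (‖y‖ ^ (p - 2) * inner ℝ y x) := by
  have hxp : 0 ≤ ‖x‖ ^ p := by positivity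
  have hyp : 0 ≤ ‖y‖ ^ p := by positivity
  have hp1 : 0 < p - 1 := by linarith
  -- Monotonicity of $x\mapsto|x|^{p-2}x$, obtained from the sum of the two Picone gaps divided by
  -- `p`. It absorbs all terms with `k`, which come from the derivative of the cutoff.
  have hm : 0 ≤ ‖x‖ ^ p + ‖y‖ ^ p - ‖x‖ ^ (p - 2) * inner ℝ x y
      - ‖y‖ ^ (p - 2) * inner ℝ y x := by
    have h1 := piconeGap_nonneg hp x y
    have h2 := piconeGap_nonneg hp y x
    unfold piconeGap at h1 h2
    have : 0 ≤ p * (‖x‖ ^ p + ‖y‖ ^ p - ‖x‖ ^ (p - 2) * inner ℝ x y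
      - ‖y‖ ^ (p - 2) * inner ℝ y x) := by linarith
    exact nonneg_of_mul_nonneg_right this (by linarith)
  have h1 := mul_nonneg hk hm
  have h2 : 0 ≤ (1 - l) * (p - 1) * (1 - s) * ‖x‖ ^ p := by
    have := sub_nonneg.2 hl1
    have := sub_nonneg.2 hs1
    positivity
  have h3 : 0 ≤ (1 - l) * (p - 1) * s * ‖y‖ ^ p := by
    have := sub_nonneg.2 hl1
    positivity
  unfold piconeGap
  -- The right side minus the left side is exactly the sum of the three nonnegative terms.
  nlinarith [h1, h2, h3]

end Picone

/-! ### Profiles cut off below the diagonal. -/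

section Cutoff

/-- A smooth nondecreasing function that vanishes on `(-∞, 1]` and is one on `[2, ∞)`. -/
noncomputable def cutoff (r : ℝ) : ℝ := Real.smoothTransition (r - 1)

theorem contDiff_cutoff : ContDiff ℝ ∞ cutoff :=
  Real.smoothTransition.contDiff.comp (contDiff_id.sub contDiff_const)

theorem cutoff_nonneg (r : ℝ) : 0 ≤ cutoff r := Real.smoothTransition.nonneg _

theorem cutoff_le_one (r : ℝ) : cutoff r ≤ 1 := Real.smoothTransition.le_one _

theorem cutoff_of_le_one {r : ℝ} (h : r ≤ 1) : cutoff r = 0 :=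
  Real.smoothTransition.zero_of_nonpos (by linarith)

theorem cutoff_pos {r : ℝ} (h : 1 < r) : 0 < cutoff r :=
  Real.smoothTransition.pos_of_pos (by linarith)

theorem hasDerivAt_cutoff (r : ℝ) : HasDerivAt cutoff (deriv cutoff r) r :=
  (contDiff_cutoff.differentiable (by simp) r).hasDerivAt

theorem continuous_deriv_cutoff : Continuous (deriv cutoff) :=
  (contDiff_cutoff.of_le (by simp) : ContDiff ℝ 1 cutoff).continuous_deriv le_rfl

theorem deriv_cutoff_nonneg (r : ℝ) : 0 ≤ deriv cutoff r :=
  (Real.smoothTransition.monotone.comp fun _ _ h => sub_le_sub_right h 1).deriv_nonneg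

theorem deriv_cutoff_of_le_one {r : ℝ} (h : r ≤ 1) : deriv cutoff r = 0 := by
  have : IsLocalMin cutoff r := Eventually.of_forall fun x => by
    rw [cutoff_of_le_one h]; exact cutoff_nonneg x
  exact this.deriv_eq_zero

theorem deriv_cutoff_of_two_le {r : ℝ} (h : 2 ≤ r) : deriv cutoff r = 0 := by
  have : IsLocalMax cutoff r := Eventually.of_forall fun x => by
    have : cutoff r = 1 := Real.smoothTransition.one_of_one_le (by linarith)
    rw [this]; exact cutoff_le_one x
  exact this.deriv_eq_zero

/-- The derivative lives on $[1,2]$, where $r\ge1$, so a bound for the product with `r` bounds the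
derivative too. The product enters the `b`-derivative of `cutoff (t / b)`, the derivative alone the
`t`-derivative. -/
theorem exists_deriv_cutoff_mul_le :
    ∃ C, 0 ≤ C ∧ ∀ r, deriv cutoff r ≤ C ∧ deriv cutoff r * r ≤ C := by
  obtain ⟨C, hC⟩ := (isCompact_Icc (a := (1 : ℝ)) (b := 2)).exists_bound_of_continuousOn
    (f := fun r => deriv cutoff r * r) (continuous_deriv_cutoff.mul continuous_id).continuousOn
  have hC0 : 0 ≤ C := (norm_nonneg _).trans (hC 1 ⟨le_rfl, one_le_two⟩)
  refine ⟨C, hC0, fun r => ?_⟩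
  rcases le_or_gt r 1 with h1 | h1
  · simpa [deriv_cutoff_of_le_one h1] using hC0
  rcases le_or_gt 2 r with h2 | h2
  · simpa [deriv_cutoff_of_two_le h2] using hC0
  have h := (le_abs_self _).trans (hC r ⟨h1.le, h2.le⟩)
  exact ⟨(le_mul_of_one_le_right (deriv_cutoff_nonneg r) h1.le).trans h, h⟩

/-- The function `(b, t) ↦ A(b) B(t) cutoff(t / b)`. -/
noncomputable def cutoffProduct (A B : ℝ → ℝ) (q : ℝ × ℝ) : ℝ := A q.1 * B q.2 * cutoff (q.2 / q.1)

variable {A B : ℝ → ℝ}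

theorem cutoffProduct_diag (b : ℝ) : cutoffProduct A B (b, b) = 0 := by
  simp only [cutoffProduct]
  -- For `b = 0` the quotient is zero by convention, still at most one.
  rw [cutoff_of_le_one (div_self_le_one b), mul_zero]

theorem cutoffProduct_of_le {q : ℝ × ℝ} (hq : 0 < q.1) (h : q.2 ≤ q.1) :
    cutoffProduct A B q = 0 := by
  rw [cutoffProduct, cutoff_of_le_one ((div_le_one hq).2 h), mul_zero]

theorem cutoffProduct_nonneg (hA : ∀ b, 0 < b → 0 ≤ A b) (hB : ∀ t, 0 < t → 0 ≤ B t) {q : ℝ × ℝ}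
    (hq : 0 < q.1) : 0 ≤ cutoffProduct A B q := by
  rcases le_or_gt q.2 q.1 with h | h
  · rw [cutoffProduct_of_le hq h]
  · exact mul_nonneg (mul_nonneg (hA _ hq) (hB _ (hq.trans h))) (cutoff_nonneg _)

/-- Near a point with $t\le0<b$ one has $t<b$, so the product vanishes identically and the behaviour
of `B` off the positive axis is irrelevant. -/
theorem contDiffOn_cutoffProduct (hA : ContDiffOn ℝ ∞ A (Set.Ioi 0))
    (hB : ContDiffOn ℝ ∞ B (Set.Ioi 0)) :
    ContDiffOn ℝ ∞ (cutoffProduct A B) {q | 0 < q.1} := by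
  intro q hq
  have hq : 0 < q.1 := hq
  refine ContDiffAt.contDiffWithinAt ?_
  rcases le_or_gt q.2 0 with h | h
  · have h0 : cutoffProduct A B =ᶠ[𝓝 q] fun _ => 0 := by
      have h1 : ∀ᶠ y : ℝ × ℝ in 𝓝 q, 0 < y.1 :=
        (isOpen_lt continuous_const continuous_fst).mem_nhds hq
      have h2 : ∀ᶠ y : ℝ × ℝ in 𝓝 q, y.2 < y.1 :=
        (isOpen_lt continuous_snd continuous_fst).mem_nhds (h.trans_lt hq)
      filter_upwards [h1, h2] with y hy1 hy2 using cutoffProduct_of_le hy1 hy2.le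
    exact contDiffAt_const.congr_of_eventuallyEq h0
  · exact ((((hA.contDiffAt (Ioi_mem_nhds hq)).comp q contDiffAt_fst).mul
      ((hB.contDiffAt (Ioi_mem_nhds h)).comp q contDiffAt_snd))).mul
      (contDiff_cutoff.contDiffAt.comp q (contDiffAt_snd.div contDiffAt_fst hq.ne'))

theorem fderiv_cutoffProduct_of_le (hA : ∀ b, 0 < b → 0 ≤ A b) (hB : ∀ t, 0 < t → 0 ≤ B t)
    {q : ℝ × ℝ} (hq : 0 < q.1) (h : q.2 ≤ q.1) : fderiv ℝ (cutoffProduct A B) q = 0 :=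
  fderiv_eq_zero_of_nonneg (fun _ => cutoffProduct_nonneg hA hB) hq (cutoffProduct_of_le hq h)

theorem fderiv_cutoffProduct_fst (hA : ContDiffOn ℝ ∞ A (Set.Ioi 0))
    (hB : ContDiffOn ℝ ∞ B (Set.Ioi 0)) {b t A' : ℝ} (hb : 0 < b) (hA' : HasDerivAt A A' b) :
    fderiv ℝ (cutoffProduct A B) (b, t) (1, 0)
      = (A' * cutoff (t / b) - A b * (deriv cutoff (t / b) * (t / b) / b)) * B t := by
  have hF : HasFDerivAt (cutoffProduct A B) (fderiv ℝ (cutoffProduct A B) (b, t)) (b, t) :=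
    (((contDiffOn_cutoffProduct hA hB).contDiffAt
      ((isOpen_lt continuous_const continuous_fst).mem_nhds hb)).differentiableAt
        (by simp)).hasFDerivAt
  have h1 : HasDerivAt (fun s : ℝ => (s, t)) ((1 : ℝ), (0 : ℝ)) b :=
    (hasDerivAt_id b).prodMk (hasDerivAt_const b t)
  have h2 := hF.comp_hasDerivAt b h1
  have h3 : HasDerivAt (fun s => A s * B t * cutoff (t / s))
      (A' * B t * cutoff (t / b) + A b * B t * (deriv cutoff (t / b) * (t * (-(b ^ 2)⁻¹)))) b := by
    refine (hA'.mul_const (B t)).mul ?_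
    exact (hasDerivAt_cutoff (t / b)).comp b ((hasDerivAt_inv hb.ne').const_mul t)
  rw [h2.unique h3]
  field_simp
  ring

theorem fderiv_cutoffProduct_snd (hA : ContDiffOn ℝ ∞ A (Set.Ioi 0))
    (hB : ContDiffOn ℝ ∞ B (Set.Ioi 0)) {b t B' : ℝ} (hb : 0 < b) (hB' : HasDerivAt B B' t) :
    fderiv ℝ (cutoffProduct A B) (b, t) (0, 1)
      = A b * (B' * cutoff (t / b) + B t * (deriv cutoff (t / b) / b)) := by
  have hF : HasFDerivAt (cutoffProduct A B) (fderiv ℝ (cutoffProduct A B) (b, t)) (b, t) :=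
    (((contDiffOn_cutoffProduct hA hB).contDiffAt
      ((isOpen_lt continuous_const continuous_fst).mem_nhds hb)).differentiableAt
        (by simp)).hasFDerivAt
  have h1 : HasDerivAt (fun s : ℝ => (b, s)) ((0 : ℝ), (1 : ℝ)) t :=
    (hasDerivAt_const t b).prodMk (hasDerivAt_id t)
  have h2 := hF.comp_hasDerivAt t h1
  have h3 : HasDerivAt (fun s => A b * B s * cutoff (s / b))
      (A b * B' * cutoff (t / b) + A b * B t * (deriv cutoff (t / b) * (1 / b))) t := by
    refine (hB'.const_mul (A b)).mul ?_
    exact HasDerivAt.comp (h₂ := cutoff) t (hasDerivAt_cutoff (t / b)) ((hasDerivAt_id t).div_const b)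
  rw [h2.unique h3]
  ring

/-- The product and its derivative vanish for $t\le b$, so the estimates on `A` and `B` are needed
only for $t>b\ge c$. Differentiating the cutoff adds at most $KC/c$. -/
theorem exists_bound_cutoffProduct (hA : ContDiffOn ℝ ∞ A (Set.Ioi 0))
    (hB : ContDiffOn ℝ ∞ B (Set.Ioi 0)) (hA0 : ∀ b, 0 < b → 0 ≤ A b) (hB0 : ∀ t, 0 < t → 0 ≤ B t)
    {A' B' : ℝ → ℝ} (hA' : ∀ b, 0 < b → HasDerivAt A (A' b) b)
    (hB' : ∀ t, 0 < t → HasDerivAt B (B' t) t) {c K : ℝ} (hc : 0 < c)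
    (h0 : ∀ b t, c ≤ b → b < t → A b * B t ≤ K) (h1 : ∀ b t, c ≤ b → b < t → |A' b| * B t ≤ K)
    (h2 : ∀ b t, c ≤ b → b < t → A b * |B' t| ≤ K) :
    ∃ M, (∀ q : ℝ × ℝ, c ≤ q.1 → cutoffProduct A B q ≤ M) ∧
      (∀ q : ℝ × ℝ, c ≤ q.1 → |fderiv ℝ (cutoffProduct A B) q (1, 0)| ≤ M) ∧
      (∀ q : ℝ × ℝ, c ≤ q.1 → |fderiv ℝ (cutoffProduct A B) q (0, 1)| ≤ M) := by
  obtain ⟨C, hC0, hC⟩ := exists_deriv_cutoff_mul_le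
  have hK : 0 ≤ K := (mul_nonneg (hA0 c hc) (hB0 (c + 1) (by linarith))).trans
    (h0 c (c + 1) le_rfl (by linarith))
  have hM : 0 ≤ K + K * (C / c) := by positivity
  refine ⟨K + K * (C / c), fun q hq => ?_, fun q hq => ?_, fun q hq => ?_⟩ <;>
    have hq0 : 0 < q.1 := hc.trans_le hq
  · rcases le_or_gt q.2 q.1 with h | h
    · rw [cutoffProduct_of_le hq0 h]; exact hM
    · have hAB := mul_nonneg (hA0 _ hq0) (hB0 _ (hq0.trans h))
      calc cutoffProduct A B q ≤ A q.1 * B q.2 := mul_le_of_le_one_right hAB (cutoff_le_one _)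
        _ ≤ K := h0 _ _ hq h
        _ ≤ K + K * (C / c) := le_add_of_nonneg_right (by positivity)
  · rcases le_or_gt q.2 q.1 with h | h
    · rw [fderiv_cutoffProduct_of_le hA0 hB0 hq0 h]; simpa using hM
    · have ht := hq0.trans h
      have hr : 0 < q.2 / q.1 := div_pos ht hq0
      rw [show q = (q.1, q.2) from rfl, fderiv_cutoffProduct_fst hA hB hq0 (hA' _ hq0), sub_mul]
      refine (abs_sub _ _).trans (add_le_add ?_ ?_)
      · rw [abs_mul, abs_mul, abs_of_nonneg (cutoff_nonneg _), abs_of_nonneg (hB0 _ ht)]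
        refine le_trans ?_ (h1 _ _ hq h)
        exact mul_le_mul_of_nonneg_right (mul_le_of_le_one_right (abs_nonneg _) (cutoff_le_one _))
          (hB0 _ ht)
      · have hd : 0 ≤ deriv cutoff (q.2 / q.1) * (q.2 / q.1) / q.1 :=
          div_nonneg (mul_nonneg (deriv_cutoff_nonneg _) hr.le) hq0.le
        rw [abs_of_nonneg (mul_nonneg (mul_nonneg (hA0 _ hq0) hd) (hB0 _ ht)), mul_right_comm]
        exact mul_le_mul (h0 _ _ hq h) (div_le_div₀ hC0 (hC _).2 hc hq) hd hK
  · rcases le_or_gt q.2 q.1 with h | h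
    · rw [fderiv_cutoffProduct_of_le hA0 hB0 hq0 h]; simpa using hM
    · have ht := hq0.trans h
      rw [show q = (q.1, q.2) from rfl, fderiv_cutoffProduct_snd hA hB hq0 (hB' _ ht), mul_add]
      refine (abs_add_le _ _).trans (add_le_add ?_ ?_)
      · rw [abs_mul, abs_mul, abs_of_nonneg (cutoff_nonneg _), abs_of_nonneg (hA0 _ hq0)]
        refine le_trans ?_ (h2 _ _ hq h)
        exact mul_le_mul_of_nonneg_left (mul_le_of_le_one_right (abs_nonneg _) (cutoff_le_one _))
          (hA0 _ hq0)
      · have hd : 0 ≤ deriv cutoff (q.2 / q.1) / q.1 := div_nonneg (deriv_cutoff_nonneg _) hq0.le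
        rw [← mul_assoc, abs_of_nonneg (mul_nonneg (mul_nonneg (hA0 _ hq0) (hB0 _ ht)) hd)]
        exact mul_le_mul (h0 _ _ hq h) (div_le_div₀ hC0 (hC _).1 hc hq) hd hK

end Cutoff

/-! ### Damped profiles and the Picone estimate for them. -/

section Profiles

/-- The damping factor `1 / (1 + ε t)`. -/
noncomputable def damping (ε t : ℝ) : ℝ := (1 + ε * t)⁻¹

variable {ε t p : ℝ}

theorem damping_pos (hε : 0 ≤ ε) (ht : 0 ≤ t) : 0 < damping ε t := by unfold damping; positivity

theorem damping_le_one (hε : 0 ≤ ε) (ht : 0 ≤ t) : damping ε t ≤ 1 :=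
  inv_le_one_of_one_le₀ (by have := mul_nonneg hε ht; linarith)

theorem mul_damping_le (hε : 0 < ε) (ht : 0 ≤ t) : t * damping ε t ≤ 1 / ε := by
  have : 0 < 1 + ε * t := by positivity
  rw [damping, ← div_eq_mul_inv, div_le_div_iff₀ this hε]
  nlinarith

/-- Eliminates `ε` from the derivatives of the damped powers. -/
theorem eps_mul_damping (hε : 0 ≤ ε) (ht : 0 ≤ t) : ε * t * damping ε t = 1 - damping ε t := by
  have : 0 < 1 + ε * t := by positivity
  unfold damping
  field_simp
  ring

theorem damping_anti {δ : ℝ} (hε : 0 ≤ ε) (h : ε ≤ δ) (ht : 0 ≤ t) : damping δ t ≤ damping ε t := by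
  unfold damping
  gcongr

theorem contDiffOn_damping_rpow (hε : 0 ≤ ε) :
    ContDiffOn ℝ ∞ (fun t => damping ε t ^ p) (Set.Ioi 0) := by
  intro t ht
  have ht : 0 < t := ht
  have h1 : ContDiffAt ℝ ∞ (fun t => damping ε t) t :=
    (contDiffAt_const.add (contDiffAt_const.mul contDiffAt_id)).inv
      (show 1 + ε * t ≠ 0 by positivity)
  exact (h1.rpow_const_of_ne (damping_pos hε ht.le).ne').contDiffWithinAt

theorem hasDerivAt_damping_rpow (hε : 0 ≤ ε) (ht : 0 < t) :
    HasDerivAt (fun t => damping ε t ^ p) (-(p * ε * (damping ε t ^ p * damping ε t))) t := by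
  have h0 : 1 + ε * t ≠ 0 := by positivity
  have h1 : HasDerivAt (fun t => damping ε t) (-ε / (1 + ε * t) ^ 2) t := by
    have := (((hasDerivAt_id t).const_mul ε).const_add 1).inv (by simpa using h0)
    exact this.congr_deriv (by simp)
  have hd := damping_pos hε ht.le
  refine (h1.rpow_const (p := p) (Or.inl hd.ne')).congr_deriv ?_
  rw [Real.rpow_sub_one hd.ne']
  have : -ε / (1 + ε * t) ^ 2 = -ε * damping ε t ^ 2 := by
    unfold damping; rw [inv_pow, div_eq_mul_inv]
  rw [this]
  field_simp

theorem contDiffOn_mul_damping_rpow (hε : 0 ≤ ε) :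
    ContDiffOn ℝ ∞ (fun t => t * damping ε t ^ p) (Set.Ioi 0) :=
  contDiffOn_id.mul (contDiffOn_damping_rpow hε)

theorem contDiffOn_rpow_Ioi : ContDiffOn ℝ ∞ (fun t : ℝ => t ^ p) (Set.Ioi 0) := fun _ ht =>
  (contDiffAt_id.rpow_const_of_ne (ne_of_gt ht)).contDiffWithinAt

theorem contDiffOn_rpow_mul_damping_rpow (hε : 0 ≤ ε) :
    ContDiffOn ℝ ∞ (fun t => t ^ p * damping ε t ^ p) (Set.Ioi 0) :=
  contDiffOn_rpow_Ioi.mul (contDiffOn_damping_rpow hε)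

theorem hasDerivAt_mul_damping_rpow (hε : 0 ≤ ε) (ht : 0 < t) :
    HasDerivAt (fun t => t * damping ε t ^ p)
      (damping ε t ^ p * (1 - p + p * damping ε t)) t := by
  refine ((hasDerivAt_id t).mul (hasDerivAt_damping_rpow (p := p) hε ht)).congr_deriv ?_
  have := eps_mul_damping hε ht.le
  simp only [id]
  linear_combination (-p * damping ε t ^ p) * this

theorem hasDerivAt_rpow_mul_damping_rpow (hε : 0 ≤ ε) (ht : 0 < t) :
    HasDerivAt (fun t => t ^ p * damping ε t ^ p)
      (p * t ^ (p - 1) * damping ε t ^ p * damping ε t) t := by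
  refine ((Real.hasDerivAt_rpow_const (Or.inl ht.ne')).mul
    (hasDerivAt_damping_rpow (p := p) hε ht)).congr_deriv ?_
  have h := eps_mul_damping hε ht.le
  have h2 : t ^ p = t ^ (p - 1) * t := by rw [Real.rpow_sub_one ht.ne']; field_simp
  rw [h2]
  linear_combination (-p * t ^ (p - 1) * damping ε t ^ p) * h

theorem damping_rpow_le_one (hε : 0 ≤ ε) (ht : 0 ≤ t) (hp : 0 ≤ p) : damping ε t ^ p ≤ 1 :=
  Real.rpow_le_one (damping_pos hε ht).le (damping_le_one hε ht) hp

/-- The test function profile for the subsolution. -/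
noncomputable def subProfile (p ε : ℝ) : ℝ × ℝ → ℝ :=
  cutoffProduct (fun _ => 1) fun t => t * damping ε t ^ p

/-- The test function profile for the supersolution. -/
noncomputable def superProfile (p ε : ℝ) : ℝ × ℝ → ℝ :=
  cutoffProduct (fun b => b ^ (1 - p)) fun t => t ^ p * damping ε t ^ p

/-- The profile `(b, t) ↦ cutoff (t / b)`. -/
noncomputable def ratioProfile : ℝ × ℝ → ℝ := cutoffProduct (fun _ => 1) fun _ => 1

/-- With $d$ the damping factor, $d^p\le d$ and $td\le1/\varepsilon$ bound the profile. In the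
derivative, $1-p+pd$ lies between $1-p$ and $1$. -/
theorem exists_bound_subProfile (hε : 0 < ε) (hp : 1 < p) {c : ℝ} (hc : 0 < c) :
    ∃ M, (∀ q : ℝ × ℝ, c ≤ q.1 → subProfile p ε q ≤ M) ∧
      (∀ q : ℝ × ℝ, c ≤ q.1 → |fderiv ℝ (subProfile p ε) q (1, 0)| ≤ M) ∧
      (∀ q : ℝ × ℝ, c ≤ q.1 → |fderiv ℝ (subProfile p ε) q (0, 1)| ≤ M) := by
  have hB0 : ∀ t, 0 < t → 0 ≤ t * damping ε t ^ p := fun t ht =>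
    mul_nonneg ht.le (Real.rpow_nonneg (damping_pos hε.le ht.le).le p)
  refine exists_bound_cutoffProduct (K := 1 / ε + p) contDiffOn_const
    (contDiffOn_mul_damping_rpow hε.le) (fun _ _ => zero_le_one) hB0
    (fun b _ => hasDerivAt_const b (1 : ℝ)) (fun t ht => hasDerivAt_mul_damping_rpow hε.le ht) hc
    (fun b t hb ht => ?_) (fun b t hb ht => ?_) (fun b t hb ht => ?_) <;>
    have ht0 : 0 < t := hc.trans (hb.trans_lt ht) <;>
    have hd := damping_pos hε.le ht0.le <;> have hd1 := damping_le_one hε.le ht0.le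
  · have : damping ε t ^ p ≤ damping ε t := Real.rpow_le_self_of_le_one hd.le hd1 hp.le
    have h1 : t * damping ε t ^ p ≤ t * damping ε t := mul_le_mul_of_nonneg_left this ht0.le
    have h2 := mul_damping_le hε ht0.le
    linarith
  · rw [abs_zero, zero_mul]; positivity
  · rw [one_mul, abs_mul, abs_of_nonneg (Real.rpow_nonneg hd.le p)]
    have h1 : |1 - p + p * damping ε t| ≤ p := by
      rw [abs_le]
      constructor <;> nlinarith
    have h2 := mul_le_mul (damping_rpow_le_one hε.le ht0.le (by linarith : 0 ≤ p)) h1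
      (abs_nonneg _) zero_le_one
    have h3 : 0 < 1 / ε := by positivity
    linarith

/-- Nonpositive powers of `b` are largest at `c`, and `t` times the damping factor is at most
$1/\varepsilon$. The constants `K₀`, `K₁`, `K₂` bound $AB$, $|A'|B$ and $A|B'|$; in the last one
$t\ge c$ supplies the factor $1/c$. -/
theorem exists_bound_superProfile (hε : 0 < ε) (hp : 1 < p) {c : ℝ} (hc : 0 < c) :
    ∃ M, (∀ q : ℝ × ℝ, c ≤ q.1 → superProfile p ε q ≤ M) ∧
      (∀ q : ℝ × ℝ, c ≤ q.1 → |fderiv ℝ (superProfile p ε) q (1, 0)| ≤ M) ∧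
      (∀ q : ℝ × ℝ, c ≤ q.1 → |fderiv ℝ (superProfile p ε) q (0, 1)| ≤ M) := by
  have hp0 : 0 < p := by linarith
  have hB0 : ∀ t, 0 < t → 0 ≤ t ^ p * damping ε t ^ p := fun t ht =>
    mul_nonneg (Real.rpow_nonneg ht.le p) (Real.rpow_nonneg (damping_pos hε.le ht.le).le p)
  have hBle : ∀ t, 0 < t → t ^ p * damping ε t ^ p ≤ (1 / ε) ^ p := fun t ht => by
    rw [← Real.mul_rpow ht.le (damping_pos hε.le ht.le).le]
    exact Real.rpow_le_rpow (mul_nonneg ht.le (damping_pos hε.le ht.le).le)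
      (mul_damping_le hε ht.le) hp0.le
  have hcp : ∀ {b s : ℝ}, c ≤ b → s ≤ 0 → b ^ s ≤ c ^ s := fun hb hs =>
    Real.rpow_le_rpow_of_nonpos hc hb hs
  set K₀ := c ^ (1 - p) * (1 / ε) ^ p with hK₀
  set K₁ := (p - 1) * c ^ (1 - p - 1) * (1 / ε) ^ p with hK₁
  set K₂ := c ^ (1 - p) * (p * ((1 / ε) ^ p / c)) with hK₂
  have hK₀n : 0 ≤ K₀ := by positivity
  have hK₁n : 0 ≤ K₁ := by
    have : 0 < p - 1 := by linarith
    positivity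
  have hK₂n : 0 ≤ K₂ := by positivity
  refine exists_bound_cutoffProduct (K := K₀ + K₁ + K₂) contDiffOn_rpow_Ioi
    (contDiffOn_rpow_mul_damping_rpow hε.le) (fun b hb => Real.rpow_nonneg hb.le _) hB0
    (fun b hb => Real.hasDerivAt_rpow_const (p := 1 - p) (Or.inl hb.ne'))
    (fun t ht => hasDerivAt_rpow_mul_damping_rpow hε.le ht) hc
    (fun b t hb ht => ?_) (fun b t hb ht => ?_) (fun b t hb ht => ?_) <;>
    have hb0 : 0 < b := hc.trans_le hb <;>
    have ht0 : 0 < t := hb0.trans ht <;>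
    have hd := damping_pos hε.le ht0.le <;> have hd1 := damping_le_one hε.le ht0.le
  · have : b ^ (1 - p) * (t ^ p * damping ε t ^ p) ≤ K₀ :=
      mul_le_mul (hcp hb (by linarith)) (hBle t ht0) (hB0 t ht0) (by positivity)
    linarith
  · have : |(1 - p) * b ^ (1 - p - 1)| * (t ^ p * damping ε t ^ p) ≤ K₁ := by
      rw [abs_mul, abs_of_nonneg (Real.rpow_nonneg hb0.le _),
        abs_of_nonpos (by linarith : 1 - p ≤ 0), neg_sub]
      have hp1 : 0 ≤ p - 1 := by linarith
      exact mul_le_mul (mul_le_mul_of_nonneg_left (hcp hb (by linarith)) hp1) (hBle t ht0)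
        (hB0 t ht0) (by positivity)
    linarith
  · have hd' : p * t ^ (p - 1) * damping ε t ^ p * damping ε t
        = p * (t ^ p * damping ε t ^ p / t * damping ε t) := by
      rw [Real.rpow_sub_one ht0.ne']; ring
    have h1 : t ^ p * damping ε t ^ p / t * damping ε t ≤ (1 / ε) ^ p / c := by
      refine (mul_le_of_le_one_right (div_nonneg (hB0 t ht0) ht0.le) hd1).trans ?_
      exact div_le_div₀ (by positivity) (hBle t ht0) hc (hb.trans ht.le)
    have : b ^ (1 - p) * |p * t ^ (p - 1) * damping ε t ^ p * damping ε t| ≤ K₂ := by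
      rw [hd', abs_of_nonneg (mul_nonneg hp0.le (mul_nonneg (div_nonneg (hB0 t ht0) ht0.le) hd.le))]
      exact mul_le_mul (hcp hb (by linarith)) (mul_le_mul_of_nonneg_left h1 hp0.le)
        (mul_nonneg hp0.le (mul_nonneg (div_nonneg (hB0 t ht0) ht0.le) hd.le)) (by positivity)
    linarith

theorem exists_bound_ratioProfile {c : ℝ} (hc : 0 < c) :
    ∃ M, (∀ q : ℝ × ℝ, c ≤ q.1 → ratioProfile q ≤ M) ∧
      (∀ q : ℝ × ℝ, c ≤ q.1 → |fderiv ℝ ratioProfile q (1, 0)| ≤ M) ∧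
      (∀ q : ℝ × ℝ, c ≤ q.1 → |fderiv ℝ ratioProfile q (0, 1)| ≤ M) :=
  exists_bound_cutoffProduct (K := 1) contDiffOn_const contDiffOn_const (fun _ _ => zero_le_one)
    (fun _ _ => zero_le_one) (fun b _ => hasDerivAt_const b (1 : ℝ))
    (fun t _ => hasDerivAt_const t (1 : ℝ)) hc (by simp) (by simp) (by simp)

variable {H : Type*} [NormedAddCommGroup H] [InnerProductSpace ℝ H]

/-- The logarithmic form of the chain rule for the profile of the subsolution. -/
theorem fderiv_subProfile_combination (hε : 0 ≤ ε) {b : ℝ} (hb : 0 < b) (ht : 0 < t) (x y : H) :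
    fderiv ℝ (subProfile p ε) (b, t) (1, 0) • (b • y)
        + fderiv ℝ (subProfile p ε) (b, t) (0, 1) • (t • x)
      = (t * damping ε t ^ p) • (((1 - p + p * damping ε t) * cutoff (t / b)
          + deriv cutoff (t / b) * (t / b)) • x - (deriv cutoff (t / b) * (t / b)) • y) := by
  rw [subProfile, fderiv_cutoffProduct_fst contDiffOn_const (contDiffOn_mul_damping_rpow hε) hb
      (hasDerivAt_const b (1 : ℝ)), fderiv_cutoffProduct_snd contDiffOn_const
      (contDiffOn_mul_damping_rpow hε) hb (hasDerivAt_mul_damping_rpow hε ht)]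
  match_scalars
  · field_simp
    ring
  · field_simp

/-- The logarithmic form of the chain rule for the profile of the supersolution. -/
theorem fderiv_superProfile_combination (hε : 0 ≤ ε) {b : ℝ} (hb : 0 < b) (ht : 0 < t) (x y : H) :
    fderiv ℝ (superProfile p ε) (b, t) (1, 0) • (b • y)
        + fderiv ℝ (superProfile p ε) (b, t) (0, 1) • (t • x)
      = (b ^ (1 - p) * t ^ p * damping ε t ^ p) • (((1 - p) * cutoff (t / b)
          - deriv cutoff (t / b) * (t / b)) • y + (p * damping ε t * cutoff (t / b)
          + deriv cutoff (t / b) * (t / b)) • x) := by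
  rw [superProfile, fderiv_cutoffProduct_fst contDiffOn_rpow_Ioi
      (contDiffOn_rpow_mul_damping_rpow hε) hb
      (Real.hasDerivAt_rpow_const (p := 1 - p) (Or.inl hb.ne')),
    fderiv_cutoffProduct_snd contDiffOn_rpow_Ioi
      (contDiffOn_rpow_mul_damping_rpow hε) hb (hasDerivAt_rpow_mul_damping_rpow hε ht),
    Real.rpow_sub_one hb.ne', Real.rpow_sub_one ht.ne']
  match_scalars
  · field_simp
  · field_simp

/-- The profile depends on $t/b$ only, so it sees only the difference of the logarithmic gradients.
-/
theorem fderiv_ratioProfile_combination {b : ℝ} (hb : 0 < b) (x y : H) :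
    fderiv ℝ ratioProfile (b, t) (1, 0) • (b • y) + fderiv ℝ ratioProfile (b, t) (0, 1) • (t • x)
      = (deriv cutoff (t / b) * (t / b)) • (x - y) := by
  rw [ratioProfile, fderiv_cutoffProduct_fst contDiffOn_const contDiffOn_const hb
      (hasDerivAt_const b (1 : ℝ)), fderiv_cutoffProduct_snd contDiffOn_const
      contDiffOn_const hb (hasDerivAt_const t (1 : ℝ))]
  match_scalars
  · field_simp
    ring
  · field_simp
    ring

theorem norm_smul_rpow_mul_inner {b : ℝ} (hb : 0 < b) (y z : H) :
    ‖b • y‖ ^ (p - 2) * inner ℝ (b • y) z = b ^ (p - 1) * (‖y‖ ^ (p - 2) * inner ℝ y z) := by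
  have h : b ^ (p - 1) = b ^ (p - 2) * b := by
    rw [← Real.rpow_add_one hb.ne']; ring_nf
  rw [norm_smul, Real.norm_of_nonneg hb.le, Real.mul_rpow hb.le (norm_nonneg y),
    real_inner_smul_left, h]
  ring

/-- The Picone type inequality for the test functions built from the two profiles. -/
theorem piconeGap_le_profiles (hp : 1 < p) (hε : 0 ≤ ε) (hε1 : ε ≤ 1) {b : ℝ} (hb : 0 < b)
    (ht : 0 < t) (a d : H) :
    damping 1 t ^ p * damping 1 t * t ^ p * cutoff (t / b) * piconeGap p (t⁻¹ • a) (b⁻¹ • d)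
        - (p - 1) * ((1 - damping ε t) * ‖a‖ ^ p) ≤
      ‖a‖ ^ (p - 2) * inner ℝ a (fderiv ℝ (subProfile p ε) (b, t) (1, 0) • d
          + fderiv ℝ (subProfile p ε) (b, t) (0, 1) • a)
        - ‖d‖ ^ (p - 2) * inner ℝ d (fderiv ℝ (superProfile p ε) (b, t) (1, 0) • d
          + fderiv ℝ (superProfile p ε) (b, t) (0, 1) • a) := by
  -- Here `x` and `y` are the logarithmic gradients, in which the flux terms become homogeneous.
  obtain ⟨x, rfl⟩ : ∃ x, a = t • x := ⟨t⁻¹ • a, by rw [smul_inv_smul₀ ht.ne']⟩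
  obtain ⟨y, rfl⟩ : ∃ y, d = b • y := ⟨b⁻¹ • d, by rw [smul_inv_smul₀ hb.ne']⟩
  rw [inv_smul_smul₀ ht.ne', inv_smul_smul₀ hb.ne', fderiv_subProfile_combination hε hb ht,
    fderiv_superProfile_combination hε hb ht, norm_smul_rpow_mul_inner ht,
    norm_smul_rpow_mul_inner hb]
  set k := deriv cutoff (t / b) * (t / b) with hk
  set s := cutoff (t / b) with hs
  set l := damping ε t with hl
  have hl0 : 0 < l := damping_pos hε ht.le
  have hl1 : l ≤ 1 := damping_le_one hε ht.le
  have hk0 : 0 ≤ k := mul_nonneg (deriv_cutoff_nonneg _) (div_pos ht hb).le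
  have key := le_picone_combination hp x y hl1 (cutoff_nonneg (t / b)) (cutoff_le_one (t / b)) hk0
  have hw : 0 < t ^ p * l ^ p := by positivity
  have key2 := mul_le_mul_of_nonneg_left key hw.le
  -- These two identities give both flux terms the same weight $t^pl^p$.
  have e1 : t ^ (p - 1) * t = t ^ p := by rw [← Real.rpow_add_one ht.ne']; ring_nf
  have e2 : b ^ (p - 1) * b ^ (1 - p) = 1 := by
    rw [← Real.rpow_add hb]; norm_num
  have ex := norm_rpow_sub_two_mul_inner_self hp x
  have ey := norm_rpow_sub_two_mul_inner_self hp y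
  have hR : t ^ (p - 1) * (‖x‖ ^ (p - 2) * inner ℝ x ((t * l ^ p) •
        (((1 - p + p * l) * s + k) • x - k • y)))
      - b ^ (p - 1) * (‖y‖ ^ (p - 2) * inner ℝ y ((b ^ (1 - p) * t ^ p * l ^ p) •
        (((1 - p) * s - k) • y + (p * l * s + k) • x)))
      = t ^ p * l ^ p * (((1 - p + p * l) * s + k) * ‖x‖ ^ p
        - k * (‖x‖ ^ (p - 2) * inner ℝ x y)
        - ((1 - p) * s - k) * ‖y‖ ^ p - (p * l * s + k) * (‖y‖ ^ (p - 2) * inner ℝ y x)) := by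
    simp only [inner_smul_right, inner_sub_right, inner_add_right]
    rw [← ex, ← ey]
    linear_combination (l ^ p * (((1 - p + p * l) * s + k) * (‖x‖ ^ (p - 2) * inner ℝ x x)
      - k * (‖x‖ ^ (p - 2) * inner ℝ x y))) * e1 - (t ^ p * l ^ p * (((1 - p) * s - k) *
      (‖y‖ ^ (p - 2) * inner ℝ y y) + (p * l * s + k) * (‖y‖ ^ (p - 2) * inner ℝ y x))) * e2
  rw [hR]
  refine le_trans ?_ key2
  have hD := piconeGap_nonneg hp x y
  -- Replacing `l` by its value at `ε = 1` in front of the gap makes the gap term independent of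
  -- `ε`. In the error term the factor $l^p\le1$ is dropped.
  have hd1 : damping 1 t ≤ l := damping_anti hε hε1 ht.le
  have hd0 : 0 < damping 1 t := damping_pos zero_le_one ht.le
  have hdp : damping 1 t ^ p * damping 1 t ≤ l ^ p * l :=
    mul_le_mul (Real.rpow_le_rpow hd0.le hd1 (by linarith)) hd1 hd0.le (by positivity)
  have hs0 : 0 ≤ s := cutoff_nonneg _
  have h1 : damping 1 t ^ p * damping 1 t * (t ^ p * s * piconeGap p x y)
      ≤ l ^ p * l * (t ^ p * s * piconeGap p x y) :=
    mul_le_mul_of_nonneg_right hdp (by positivity)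
  have hn : ‖t • x‖ ^ p = t ^ p * ‖x‖ ^ p := by
    rw [norm_smul, Real.norm_of_nonneg ht.le, Real.mul_rpow ht.le (norm_nonneg x)]
  have hlp : l ^ p ≤ 1 := damping_rpow_le_one hε ht.le (by linarith)
  have h2 : l ^ p * ((p - 1) * ((1 - l) * (t ^ p * ‖x‖ ^ p)))
      ≤ (p - 1) * ((1 - l) * (t ^ p * ‖x‖ ^ p)) := by
    refine mul_le_of_le_one_left ?_ hlp
    have : 0 ≤ 1 - l := by linarith
    have : 0 ≤ p - 1 := by linarith
    positivity
  rw [hn]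
  nlinarith [h1, h2]

end Profiles

/-! ### Integrability and convergence of the flux terms. -/

section Integrability

variable {α H : Type*} [MeasurableSpace α] {ν : Measure α}
  [NormedAddCommGroup H] [InnerProductSpace ℝ H]

theorem norm_rpow_sub_two_smul {p : ℝ} (hp : 1 < p) (x : H) :
    ‖‖x‖ ^ (p - 2) • x‖ = ‖x‖ ^ (p - 1) := by
  rcases eq_or_ne x 0 with rfl | hx
  · rw [smul_zero, norm_zero, Real.zero_rpow (by linarith)]
  · rw [norm_smul, Real.norm_of_nonneg (by positivity), ← Real.rpow_add_one (norm_ne_zero_iff.2 hx)]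
    ring_nf

theorem abs_abs_rpow_sub_two_mul {p : ℝ} (hp : 1 < p) (s : ℝ) :
    |(|s| ^ (p - 2) * s)| = |s| ^ (p - 1) := norm_rpow_sub_two_smul hp s

/-- The norm of the flux is $|D|^{p-1}$, and $(p-1)p'=p$ for the conjugate exponent $p'$. -/
theorem MeasureTheory.MemLp.rpow_sub_two_smul {p : ℝ} (hp : 1 < p) {D : α → H}
    (hD : MemLp D (ENNReal.ofReal p) ν) :
    MemLp (fun x => ‖D x‖ ^ (p - 2) • D x) (ENNReal.ofReal (p.conjExponent)) ν := by
  have hp1 : 0 < p - 1 := by linarith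
  have h := hD.norm_rpow_div (ENNReal.ofReal (p - 1))
  rw [ENNReal.toReal_ofReal hp1.le, ← ENNReal.ofReal_div_of_pos hp1] at h
  refine h.of_le ((hD.1.norm.aemeasurable.pow_const _).aestronglyMeasurable.smul hD.1) ?_
  refine Eventually.of_forall fun x => ?_
  rw [norm_rpow_sub_two_smul hp]
  exact le_abs_self _

theorem integrable_flux {p : ℝ} (hp : 1 < p) {D Φ : α → H}
    (hD : MemLp D (ENNReal.ofReal p) ν) (hΦ : MemLp Φ (ENNReal.ofReal p) ν) :
    Integrable (fun x => ‖D x‖ ^ (p - 2) * inner ℝ (D x) (Φ x)) ν := by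
  have hH : ENNReal.HolderConjugate (ENNReal.ofReal p.conjExponent) (ENNReal.ofReal p) :=
    (Real.HolderConjugate.conjExponent hp).symm.ennrealOfReal
  have hZ := hD.rpow_sub_two_smul hp
  rw [← memLp_one_iff_integrable]
  have := MemLp.of_bilin (r := 1) (fun a b : H => inner ℝ a b) 1 hZ hΦ (hZ.1.inner hΦ.1)
    (Eventually.of_forall fun x => by simpa using! nnnorm_inner_le_nnnorm _ _)
  simpa only [real_inner_smul_left] using this

/-- Convergence of the flux terms in the weak formulation. -/
theorem tendsto_integral_flux {p : ℝ} (hp : 1 < p) {D Φ : α → H} {Ψ : ℕ → α → H}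
    (hD : MemLp D (ENNReal.ofReal p) ν) (hΦ : MemLp Φ (ENNReal.ofReal p) ν)
    (hΨ : ∀ n, MemLp (Ψ n) (ENNReal.ofReal p) ν)
    (h : Tendsto (fun n => eLpNorm (fun x => Ψ n x - Φ x) (ENNReal.ofReal p) ν) atTop (𝓝 0)) :
    Tendsto (fun n => ∫ x, ‖D x‖ ^ (p - 2) * inner ℝ (D x) (Ψ n x) ∂ν) atTop
      (𝓝 (∫ x, ‖D x‖ ^ (p - 2) * inner ℝ (D x) (Φ x) ∂ν)) := by
  have hH : ENNReal.HolderConjugate (ENNReal.ofReal p.conjExponent) (ENNReal.ofReal p) :=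
    (Real.HolderConjugate.conjExponent hp).symm.ennrealOfReal
  have hZ := hD.rpow_sub_two_smul hp
  refine tendsto_integral_of_L1' _ (integrable_flux hp hD hΦ).1
    (Eventually.of_forall fun n => integrable_flux hp hD (hΨ n)) ?_
  have h2 := ENNReal.Tendsto.const_mul h (Or.inr hZ.2.ne)
  rw [mul_zero] at h2
  refine tendsto_of_tendsto_of_tendsto_of_le_of_le tendsto_const_nhds h2 (fun _ => zero_le)
    fun n => ?_
  have h3 := eLpNorm_le_eLpNorm_mul_eLpNorm_of_nnnorm (p := ENNReal.ofReal p.conjExponent)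
    (q := ENNReal.ofReal p) (r := 1) hZ.1 ((hΨ n).1.sub hΦ.1)
    (fun a b : H => inner ℝ a b) 1
    (Eventually.of_forall fun x => by simpa using! nnnorm_inner_le_nnnorm _ _)
  rw [ENNReal.coe_one, one_mul] at h3
  refine le_trans (le_of_eq ?_) h3
  congr 1
  ext1 x
  simp only [Pi.sub_apply, real_inner_smul_left, inner_sub_right]

end Integrability

/-! ### Limits in the weak formulation, Sobolev's inequality, lower-order terms. -/

section WeakInequality

variable {N : ℕ} {Ω : Set (EuclideanSpace ℝ (Fin N))}

/-- Passing to the limit along bounded test functions in an inequality of weak form. -/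
theorem integral_flux_le_of_tendsto (hΩ : volume Ω ≠ ⊤) {p : ℝ} (hp : 1 < p)
    {D Φ : EuclideanSpace ℝ (Fin N) → EuclideanSpace ℝ (Fin N)}
    {h k : EuclideanSpace ℝ (Fin N) → ℝ} (hD : MemLp D (ENNReal.ofReal p) (volume.restrict Ω))
    (hΦ : MemLp Φ (ENNReal.ofReal p) (volume.restrict Ω)) (hh : IntegrableOn h Ω)
    (hk : IntegrableOn k Ω)
    (hweak : ∀ φ : EuclideanSpace ℝ (Fin N) → ℝ, IsTestFunction Ω φ → (∀ x, 0 ≤ φ x) →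
      ∫ x in Ω, (‖D x‖ ^ (p - 2) * inner ℝ (D x) ((∇ φ) x) - h x * φ x) ≤ ∫ x in Ω, k x * φ x)
    {φ : ℕ → EuclideanSpace ℝ (Fin N) → ℝ} {χ : EuclideanSpace ℝ (Fin N) → ℝ} {M : ℝ}
    (hφ : ∀ n, IsTestFunction Ω (φ n)) (hφ0 : ∀ n x, 0 ≤ φ n x) (hφM : ∀ n x, φ n x ≤ M)
    (hφχ : ∀ᵐ x ∂(volume.restrict Ω), Tendsto (fun n => φ n x) atTop (𝓝 (χ x)))
    (hφΦ : Tendsto (fun n => eLpNorm (fun x => (∇ (φ n)) x - Φ x) (ENNReal.ofReal p)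
      (volume.restrict Ω)) atTop (𝓝 0)) :
    IntegrableOn (fun x => (h x + k x) * χ x) Ω ∧
    ∫ x in Ω, ‖D x‖ ^ (p - 2) * inner ℝ (D x) (Φ x) ≤ ∫ x in Ω, (h x + k x) * χ x := by
  have hfin : IsFiniteMeasure (volume.restrict Ω) := isFiniteMeasure_restrict.2 hΩ
  have hΨ : ∀ n, MemLp (∇ (φ n)) (ENNReal.ofReal p) (volume.restrict Ω) := fun n => by
    obtain ⟨C, hC⟩ := (hφ n).exists_gradient_bound
    exact MemLp.of_bound ((hφ n).smooth.of_le (by simp)).continuous_gradient.aestronglyMeasurable C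
      (Eventually.of_forall hC)
  have hmul : ∀ {j : EuclideanSpace ℝ (Fin N) → ℝ}, IntegrableOn j Ω → ∀ n,
      IntegrableOn (fun x => j x * φ n x) Ω := fun hj n =>
    hj.mul_bdd (hφ n).smooth.continuous.aestronglyMeasurable (c := M)
      (Eventually.of_forall fun x => by
        rw [Real.norm_of_nonneg (hφ0 n x)]; exact hφM n x)
  have hn : ∀ n, ∫ x in Ω, ‖D x‖ ^ (p - 2) * inner ℝ (D x) ((∇ (φ n)) x)
      ≤ ∫ x in Ω, (h x + k x) * φ n x := by
    intro n
    have h1 := hweak (φ n) (hφ n) (hφ0 n)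
    rw [integral_sub (integrable_flux hp hD (hΨ n)) (hmul hh n)] at h1
    simp only [add_mul]
    rw [integral_add (hmul hh n) (hmul hk n)]
    linarith
  have hχm : AEStronglyMeasurable χ (volume.restrict Ω) := aestronglyMeasurable_of_tendsto_ae atTop
    (fun n => (hφ n).smooth.continuous.aestronglyMeasurable) hφχ
  refine ⟨(hh.add hk).mul_bdd hχm (c := M) ?_,
    le_of_tendsto_of_tendsto' (tendsto_integral_flux hp hD hΦ hΨ hφΦ) ?_ hn⟩
  · filter_upwards [hφχ] with x hx
    rw [Real.norm_of_nonneg (ge_of_tendsto' hx fun n => hφ0 n x)]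
    exact le_of_tendsto' hx fun n => hφM n x
  -- The coefficients are merely integrable, which is why the test functions must be uniformly
  -- bounded.
  · refine tendsto_integral_of_dominated_convergence (fun x => |h x + k x| * M)
      (fun n => (hmul (hh.add hk) n).1) ((hh.add hk).abs.mul_const M)
      (fun n => Eventually.of_forall fun x => ?_) ?_
    · rw [norm_mul, Real.norm_of_nonneg (hφ0 n x)]
      exact mul_le_mul_of_nonneg_left (hφM n x) (norm_nonneg _)
    · filter_upwards [hφχ] with x hx using hx.const_mul _

/-- A limit of test functions whose gradients tend to zero is zero. -/
theorem ae_eq_zero_of_tendsto_gradient (hN : 2 ≤ N) (hΩ : volume Ω ≠ ⊤) {p : ℝ} (hp : 1 ≤ p)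
    {φ : ℕ → EuclideanSpace ℝ (Fin N) → ℝ} {χ : EuclideanSpace ℝ (Fin N) → ℝ}
    (hφ : ∀ n, IsTestFunction Ω (φ n))
    (hφχ : ∀ᵐ x ∂(volume.restrict Ω), Tendsto (fun n => φ n x) atTop (𝓝 (χ x)))
    (hφg : Tendsto (fun n => eLpNorm (∇ (φ n)) (ENNReal.ofReal p) (volume.restrict Ω))
      atTop (𝓝 0)) :
    ∀ᵐ x ∂(volume.restrict Ω), χ x = 0 := by
  have hfin : IsFiniteMeasure (volume.restrict Ω) := isFiniteMeasure_restrict.2 hΩ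
  have hp1 : 1 ≤ ENNReal.ofReal p := by simpa using ENNReal.ofReal_le_ofReal hp
  have hN1 : (1 : NNReal) < (N : NNReal) := by exact_mod_cast hN
  -- This is $N/(N-1)$: the Sobolev inequality bounds the $L^q$ norm by the $L^1$ norm of the
  -- gradient, and the finite measure of `Ω` passes from $L^p$ to $L^1$.
  set q : NNReal := NNReal.conjExponent N with hq
  have hconj : NNReal.HolderConjugate (Module.finrank ℝ (EuclideanSpace ℝ (Fin N))) q := by
    rw [finrank_euclideanSpace_fin]
    exact NNReal.HolderConjugate.conjExponent hN1
  have hq0 : (q : ENNReal) ≠ 0 := by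
    simpa using hconj.symm.ne_zero
  have hle : ∀ n, eLpNorm (φ n) q (volume.restrict Ω)
      ≤ eLpNormLESNormFDerivOneConst (volume : Measure (EuclideanSpace ℝ (Fin N))) q
        * (eLpNorm (∇ (φ n)) (ENNReal.ofReal p) (volume.restrict Ω)
          * (volume.restrict Ω) Set.univ ^ (1 / (1 : ENNReal).toReal
            - 1 / (ENNReal.ofReal p).toReal)) := by
    intro n
    have h1 : ContDiff ℝ 1 (φ n) := (hφ n).smooth.of_le (by simp)
    have hS := eLpNorm_le_eLpNorm_fderiv_one (volume : Measure (EuclideanSpace ℝ (Fin N))) h1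
      (hφ n).hasCompactSupport hconj
    refine (eLpNorm_mono_measure _ Measure.restrict_le_self).trans (hS.trans ?_)
    gcongr
    have e1 : eLpNorm (fderiv ℝ (φ n)) 1 volume = eLpNorm (∇ (φ n)) 1 volume := by
      refine eLpNorm_congr_norm_ae (Eventually.of_forall fun x => ?_)
      rw [← toDual_gradient, LinearIsometryEquiv.norm_map]
    have e2 : eLpNorm (∇ (φ n)) 1 volume = eLpNorm (∇ (φ n)) 1 (volume.restrict Ω) := by
      rw [eLpNorm_one_eq_lintegral_enorm, eLpNorm_one_eq_lintegral_enorm,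
        setLIntegral_eq_of_support_subset]
      intro x hx
      by_contra hxΩ
      refine hx ?_
      beta_reduce
      rw [gradient_eq_zero_of_notMem_tsupport fun h => hxΩ ((hφ n).tsupport_subset h), enorm_zero]
    rw [e1, e2]
    exact eLpNorm_le_eLpNorm_mul_rpow_measure_univ hp1
      h1.continuous_gradient.aestronglyMeasurable
  have hlim : Tendsto (fun n => eLpNorm (φ n - 0) q (volume.restrict Ω)) atTop (𝓝 0) := by
    have hexp : 0 ≤ 1 / (1 : ENNReal).toReal - 1 / (ENNReal.ofReal p).toReal := by
      rw [ENNReal.toReal_one, ENNReal.toReal_ofReal (by linarith), sub_nonneg]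
      exact one_div_le_one_div_of_le one_pos hp
    have h2 := ENNReal.Tendsto.const_mul (a := (eLpNormLESNormFDerivOneConst
      (volume : Measure (EuclideanSpace ℝ (Fin N))) q : ENNReal)) (ENNReal.Tendsto.mul_const hφg
      (Or.inr (ENNReal.rpow_ne_top_of_nonneg hexp (measure_ne_top (volume.restrict Ω) Set.univ))))
      (Or.inr ENNReal.coe_ne_top)
    rw [zero_mul, mul_zero] at h2
    refine tendsto_of_tendsto_of_tendsto_of_le_of_le tendsto_const_nhds h2 (fun _ => zero_le)
      fun n => ?_
    rw [sub_zero]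
    exact hle n
  obtain ⟨ns, hns, hae⟩ := (tendstoInMeasure_of_tendsto_eLpNorm hq0
    (fun n => (hφ n).smooth.continuous.aestronglyMeasurable) aestronglyMeasurable_const
    hlim).exists_seq_tendsto_ae
  filter_upwards [hφχ, hae] with x h1 h2
  exact tendsto_nhds_unique (h1.comp hns.tendsto_atTop) h2

theorem integrableOn_norm_rpow_neg (hΩb : Bornology.IsBounded Ω) (hN : 1 ≤ N) {a : ℝ}
    (ha : a < N) : IntegrableOn (fun x : EuclideanSpace ℝ (Fin N) => ‖x‖ ^ (-a)) Ω := by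
  have hl : LocallyIntegrable (fun x : EuclideanSpace ℝ (Fin N) => ‖x‖ ^ (-a)) volume := by
    refine locallyIntegrable_of_norm_le_rpow (C := 1) (α := a) (by simpa using hN) (by simpa using ha)
      (Eventually.of_forall fun x => ?_)
      ((measurable_norm.pow_const _).aestronglyMeasurable)
    rw [Real.norm_of_nonneg (by positivity), one_mul]
  exact (hl.integrableOn_isCompact hΩb.isCompact_closure).mono_set subset_closure

variable {p : ℝ} {u f : EuclideanSpace ℝ (Fin N) → ℝ}

theorem aestronglyMeasurable_abs_rpow_mul {α : Type*} [MeasurableSpace α] {ν : Measure α}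
    {u : α → ℝ} {a : ℝ} (hu : AEStronglyMeasurable u ν) :
    AEStronglyMeasurable (fun x => |u x| ^ a * u x) ν :=
  (hu.norm.aemeasurable.pow_const a).aestronglyMeasurable.mul hu

/-- Integrability of the Hardy term. -/
theorem integrableOn_hardy_term (hp : 1 < p) (hpN : p < N)
    (hΩb : Bornology.IsBounded Ω) (μ : ℝ)
    (hu : MemLp u (ENNReal.ofReal (N * p / (N - p))) (volume.restrict Ω)) :
    IntegrableOn (fun x => μ / ‖x‖ ^ p * (|u x| ^ (p - 2) * u x)) Ω := by
  have hp0 : 0 < p := by linarith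
  have hp1 : 0 < p - 1 := by linarith
  have hNp : (0 : ℝ) < N - p := by linarith
  have hN0 : (0 : ℝ) < N := by linarith
  -- Chosen so that $(p-1)s=p^*$ in Young's inequality. For the conjugate exponent `r`, the
  -- condition $pr<N$ for integrability of $|x|^{-pr}$ reduces to $p<N$.
  set s : ℝ := N * p / ((N - p) * (p - 1)) with hs
  have hs1 : 1 < s := by
    rw [hs, one_lt_div (by positivity)]
    nlinarith
  set r : ℝ := s.conjExponent with hr
  have hconj : s.HolderConjugate r := Real.HolderConjugate.conjExponent hs1
  have hprN : p * r < N := by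
    have : r = N * p / (N * p - (N - p) * (p - 1)) := by
      have h2 : (N - p) * (p - 1) < N * p := by nlinarith
      have h3 : 0 < N * p - (N - p) * (p - 1) := by linarith
      have h4 : s - 1 = (N * p - (N - p) * (p - 1)) / ((N - p) * (p - 1)) := by
        rw [hs]; field_simp
      rw [hr, Real.conjExponent, h4, hs]
      field_simp
    have h3 : 0 < N * p - (N - p) * (p - 1) := by nlinarith
    rw [this, ← mul_div_assoc, div_lt_iff₀ h3]
    nlinarith [mul_pos hN0 hNp]
  have hui : IntegrableOn (fun x => ‖u x‖ ^ (N * p / (N - p))) Ω := by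
    have hq : 0 < N * p / (N - p) := by positivity
    have := hu.integrable_norm_rpow (by simpa using hq) ENNReal.ofReal_ne_top
    rwa [ENNReal.toReal_ofReal hq.le] at this
  have hxi := integrableOn_norm_rpow_neg hΩb
    (by exact_mod_cast (by linarith : (1 : ℝ) ≤ N)) hprN
  refine (((hxi.div_const r).add (hui.div_const s)).const_mul |μ|).mono' ?_ ?_
  · exact (measurable_const.div (measurable_norm.pow_const _)).aestronglyMeasurable.mul
      (aestronglyMeasurable_abs_rpow_mul hu.1)
  · refine Eventually.of_forall fun x => ?_
    have hx : 0 ≤ ‖x‖ ^ (-p) := by positivity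
    have hy := Real.young_inequality_of_nonneg hx (by positivity : 0 ≤ |u x| ^ (p - 1)) hconj.symm
    rw [← Real.rpow_mul (norm_nonneg x), ← Real.rpow_mul (abs_nonneg _)] at hy
    have e : (p - 1) * s = N * p / (N - p) := by rw [hs]; field_simp
    rw [e, neg_mul] at hy
    rw [norm_mul, norm_div, Real.norm_eq_abs, Real.norm_eq_abs (|u x| ^ (p - 2) * u x),
      abs_abs_rpow_sub_two_mul hp, Real.norm_of_nonneg (by positivity : 0 ≤ ‖x‖ ^ p), div_eq_mul_inv,
      ← Real.rpow_neg (norm_nonneg x), mul_assoc]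
    exact mul_le_mul_of_nonneg_left hy (abs_nonneg μ)

/-- Integrability of the potential term. -/
theorem integrableOn_potential_term (hp : 1 < p) (hpN : p < N) (hΩ : volume Ω ≠ ⊤)
    (hf : MemLp f (ENNReal.ofReal (N / p)) (volume.restrict Ω))
    (hu : MemLp u (ENNReal.ofReal (N * p / (N - p))) (volume.restrict Ω)) :
    IntegrableOn (fun x => f x * (|u x| ^ (p - 2) * u x)) Ω := by
  have hfin : IsFiniteMeasure (volume.restrict Ω) := isFiniteMeasure_restrict.2 hΩ
  have hp0 : 0 < p := by linarith
  have hp1 : 0 < p - 1 := by linarith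
  have hNp : (0 : ℝ) < N - p := by linarith
  have hN0 : (0 : ℝ) < N := by linarith
  set r : ℝ := N / p with hr
  have hr1 : 1 < r := by rw [hr, one_lt_div hp0]; exact hpN
  set s : ℝ := N / (N - p) with hs
  have hconj : r.HolderConjugate s := by
    have : s = r.conjExponent := by
      rw [Real.conjExponent, hr, hs]; field_simp
    rw [this]
    exact Real.HolderConjugate.conjExponent hr1
  have hq : 0 < (p - 1) * s := by positivity
  have hui : IntegrableOn (fun x => ‖u x‖ ^ ((p - 1) * s)) Ω := by
    -- The dual exponent of $N/p$ asks for less than $p^*$, and the measure is finite.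
    have hle : (p - 1) * s ≤ N * p / (N - p) := by
      rw [hs, ← mul_div_assoc]
      exact div_le_div_of_nonneg_right (by linarith) hNp.le
    have := (hu.mono_exponent (ENNReal.ofReal_le_ofReal hle)).integrable_norm_rpow
      (by simpa using hq) ENNReal.ofReal_ne_top
    rwa [ENNReal.toReal_ofReal hq.le] at this
  have hfi : IntegrableOn (fun x => ‖f x‖ ^ r) Ω := by
    have := hf.integrable_norm_rpow (by simpa using hconj.pos) ENNReal.ofReal_ne_top
    rwa [ENNReal.toReal_ofReal hconj.nonneg] at this
  refine ((hfi.div_const r).add (hui.div_const s)).mono' (hf.1.mul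
    (aestronglyMeasurable_abs_rpow_mul hu.1)) (Eventually.of_forall fun x => ?_)
  have hy := Real.young_inequality_of_nonneg (abs_nonneg (f x))
    (by positivity : 0 ≤ |u x| ^ (p - 1)) hconj
  rw [← Real.rpow_mul (abs_nonneg (u x))] at hy
  rw [norm_mul, Real.norm_eq_abs, Real.norm_eq_abs (|u x| ^ (p - 2) * u x),
    abs_abs_rpow_sub_two_mul hp]
  exact hy

theorem IsWeakGradient.neg {D : EuclideanSpace ℝ (Fin N) → EuclideanSpace ℝ (Fin N)}
    (h : IsWeakGradient Ω u D) : IsWeakGradient Ω (fun x => - u x) (fun x => - D x) where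
  locallyIntegrable := h.locallyIntegrable.neg
  locallyIntegrable_grad := h.locallyIntegrable_grad.neg
  integral_eq φ hφ := by
    simp only [neg_smul, smul_neg, integral_neg, h.integral_eq φ hφ]

end WeakInequality

/-! ### The comparison principle. -/

section Comparison

theorem subProfile_nonneg {p ε : ℝ} (hε : 0 ≤ ε) {q : ℝ × ℝ} (hq : 0 < q.1) :
    0 ≤ subProfile p ε q :=
  cutoffProduct_nonneg (fun _ _ => zero_le_one) (fun _ ht => mul_nonneg ht.le
    (Real.rpow_nonneg (damping_pos hε ht.le).le p)) hq

theorem superProfile_nonneg {p ε : ℝ} (hε : 0 ≤ ε) {q : ℝ × ℝ} (hq : 0 < q.1) :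
    0 ≤ superProfile p ε q :=
  cutoffProduct_nonneg (fun _ hb => Real.rpow_nonneg hb.le _) (fun _ ht => mul_nonneg
    (Real.rpow_nonneg ht.le p) (Real.rpow_nonneg (damping_pos hε ht.le).le p)) hq

theorem ratioProfile_nonneg {q : ℝ × ℝ} (hq : 0 < q.1) : 0 ≤ ratioProfile q :=
  cutoffProduct_nonneg (fun _ _ => zero_le_one) (fun _ _ => zero_le_one) hq

/-- The powers of the sub- and supersolution cancel against the two profiles. -/
theorem abs_rpow_mul_subProfile {p ε b t : ℝ} (hb : 0 < b) (ht : 0 < t) :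
    |t| ^ (p - 2) * t * subProfile p ε (b, t) = |b| ^ (p - 2) * b * superProfile p ε (b, t) := by
  have e : ∀ {s : ℝ}, 0 < s → |s| ^ (p - 2) * s = s ^ p * s⁻¹ := fun hs => by
    rw [abs_of_pos hs, Real.rpow_sub hs]
    norm_num
    field_simp
  have e2 : b ^ (1 - p) = b * (b ^ p)⁻¹ := by
    rw [Real.rpow_sub hb, Real.rpow_one, div_eq_mul_inv]
  have hbp : 0 < b ^ p := Real.rpow_pos_of_pos hb p
  simp only [subProfile, superProfile, cutoffProduct]
  rw [e hb, e ht, e2]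
  field_simp

end Comparison

theorem theorem3p2 (N : ℕ) (p μ : ℝ) (hp : 1 < p) (hpN : p < N)
    (hμ : 0 ≤ μ) (hμ' : μ < ((N - p) / p) ^ p)
    (Ω : Set (EuclideanSpace ℝ (Fin N))) (hΩo : IsOpen Ω) (hΩc : IsConnected Ω)
    (hΩb : Bornology.IsBounded Ω)
    (f g u v : EuclideanSpace ℝ (Fin N) → ℝ)
    (hf : MemLp f (ENNReal.ofReal (N / p)) (volume.restrict Ω))
    (hg : MemLp g (ENNReal.ofReal (N / p)) (volume.restrict Ω))
    (hfg : ∀ᵐ x ∂(volume.restrict Ω), f x ≤ g x)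
    (hu : IsWeakSubsolution p μ Ω f u)
    (hv : IsWeakSupersolution p μ Ω g v)
    (hinf : ∃ c : ℝ, 0 < c ∧ ∀ᵐ x ∂(volume.restrict Ω), c ≤ v x)
    (hbd : LeOnBoundary p Ω u v) :
    ∀ᵐ x ∂(volume.restrict Ω), u x ≤ v x := by
  obtain ⟨D, hD, hDineq⟩ := hu
  obtain ⟨W, hW, hWineq⟩ := hv
  obtain ⟨c, hc, hcv⟩ := hinf
  obtain ⟨G, hGw, hwLp, hGLp, ψ, hψ, hψw, hψG⟩ := hbd
  have hp0 : 0 < p := by linarith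
  have hN2 : 2 ≤ N := by
    have : (1 : ℝ) < N := by linarith
    exact_mod_cast this
  have hNp : (0 : ℝ) < N - p := by linarith
  have hvol : volume Ω ≠ ⊤ := hΩb.measure_lt_top.ne
  have hfin : IsFiniteMeasure (volume.restrict Ω) := isFiniteMeasure_restrict.2 hvol
  have hp1 : 1 ≤ ENNReal.ofReal p := by simpa using ENNReal.ofReal_le_ofReal hp.le
  have hps1 : 1 ≤ ENNReal.ofReal (N * p / (N - p)) := by
    rw [← ENNReal.ofReal_one]
    refine ENNReal.ofReal_le_ofReal ((one_le_div hNp).2 ?_)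
    nlinarith
  have hvLp : MemLp v (ENNReal.ofReal (N * p / (N - p))) (volume.restrict Ω) := by
    have h := hW.memLp.neg
    rwa [show (-fun x => -v x) = v from funext fun x => neg_neg (v x)] at h
  -- The supersolution hypothesis provides the gradient `W` of `-v`.
  set V : EuclideanSpace ℝ (Fin N) → EuclideanSpace ℝ (Fin N) := fun x => - W x with hVdef
  have hVLp : MemLp V (ENNReal.ofReal p) (volume.restrict Ω) := hW.memLp_grad.neg
  have hVgrad : IsWeakGradient Ω v V := by simpa using hW.isWeakGradient.neg
  have hui : IntegrableOn u Ω := hD.memLp.integrable hps1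
  have hvi : IntegrableOn v Ω := hvLp.integrable hps1
  have hDi : IntegrableOn D Ω := hD.memLp_grad.integrable hp1
  have hVi : IntegrableOn V Ω := hVLp.integrable hp1
  have hGi : IntegrableOn G Ω := hGLp.integrable hp1
  -- Thus `v + w` is the maximum of `u` and `v`, and profiles of `(v, v + w)` that vanish on the
  -- diagonal see only $\{u>v\}$.
  set w : EuclideanSpace ℝ (Fin N) → ℝ := fun x => max (u x - v x) 0 with hwdef
  have hw_le : ∀ x, u x ≤ v x → v x + w x = v x := fun x hx => by
    simp only [hwdef, max_eq_right (sub_nonpos.2 hx), add_zero]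
  have hw_gt : ∀ x, v x < u x → v x + w x = u x := fun x hx => by
    simp only [hwdef, max_eq_left (sub_nonneg.2 hx.le), add_sub_cancel]
  have hGeq : ∀ᵐ x ∂(volume.restrict Ω), v x < u x → V x + G x = D x := by
    have h := IsWeakGradient.ae_eq_of_posPart hΩo
      (hD.isWeakGradient.sub hVgrad hui hvi hDi hVi) hGw (hui.sub hvi) (hDi.sub hVi) hGi
    filter_upwards [h] with x hx hlt
    rw [hx (sub_pos.2 hlt), add_sub_cancel]
  -- the gap in Picone's inequality, with a bounded weight
  set Q : EuclideanSpace ℝ (Fin N) → ℝ := fun x =>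
    damping 1 (v x + w x) ^ p * damping 1 (v x + w x) * (v x + w x) ^ p
      * cutoff ((v x + w x) / v x) * piconeGap p ((v x + w x)⁻¹ • D x) ((v x)⁻¹ • V x) with hQ
  have hDp : IntegrableOn (fun x => ‖D x‖ ^ p) Ω := by
    have := hD.memLp_grad.integrable_norm_rpow (by simpa using hp0) ENNReal.ofReal_ne_top
    rwa [ENNReal.toReal_ofReal hp0.le] at this
  have hUm : AEMeasurable (fun x => v x + w x) (volume.restrict Ω) :=
    (hvi.1.add hwLp.1).aemeasurable
  have hdampm : ∀ ε : ℝ, AEMeasurable (fun x => damping ε (v x + w x)) (volume.restrict Ω) :=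
    fun ε => ((hUm.const_mul ε).const_add 1).inv
  have hQm : AEMeasurable Q (volume.restrict Ω) := by
    have hx : AEMeasurable (fun x => (v x + w x)⁻¹ • D x) (volume.restrict Ω) :=
      hUm.inv.smul hDi.1.aemeasurable
    have hy : AEMeasurable (fun x => (v x)⁻¹ • V x) (volume.restrict Ω) :=
      hvi.1.aemeasurable.inv.smul hVi.1.aemeasurable
    have hgap : AEMeasurable (fun x => piconeGap p ((v x + w x)⁻¹ • D x) ((v x)⁻¹ • V x))
        (volume.restrict Ω) :=
      ((hx.norm.pow_const p).add ((hy.norm.pow_const p).const_mul (p - 1))).sub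
        (((hy.norm.pow_const (p - 2)).mul (hy.inner hx)).const_mul p)
    exact (((((hdampm 1).pow_const p).mul (hdampm 1)).mul (hUm.pow_const p)).mul
      (contDiff_cutoff.continuous.measurable.comp_aemeasurable
        (hUm.div hvi.1.aemeasurable))).mul hgap
  have hUpos : ∀ᵐ x ∂(volume.restrict Ω), 0 < v x + w x := by
    filter_upwards [hcv] with x hx
    have : 0 ≤ w x := le_max_right _ _
    linarith
  have hQ0 : ∀ᵐ x ∂(volume.restrict Ω), 0 ≤ Q x := by
    filter_upwards [hUpos] with x hx
    have h1 := damping_pos zero_le_one hx.le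
    have h2 := cutoff_nonneg ((v x + w x) / v x)
    have h3 := piconeGap_nonneg hp ((v x + w x)⁻¹ • D x) ((v x)⁻¹ • V x)
    positivity
  -- `Q` does not depend on `ε`, so the right side may be sent to zero afterwards.
  have key : ∀ ε : ℝ, 0 < ε → ε ≤ 1 → IntegrableOn Q Ω ∧
      ∫ x in Ω, Q x ≤ (p - 1) * ∫ x in Ω, (1 - damping ε (v x + w x)) * ‖D x‖ ^ p := by
    intro ε hε hε1
    obtain ⟨M₁, hM₁, hM₁₁, hM₁₂⟩ := exists_bound_subProfile hε hp hc
    obtain ⟨M₂, hM₂, hM₂₁, hM₂₂⟩ := exists_bound_superProfile hε hp hc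
    obtain ⟨φ₁, hφ₁, hφ₁0, hφ₁M, hφ₁lim, hΦ₁, hφ₁g⟩ := exists_isTestFunction_tendsto
      (F := subProfile p ε) hΩo hp.le hVgrad hvi hVLp hc hcv hwLp.1 hGLp hψ hψw hψG (contDiffOn_cutoffProduct contDiffOn_const
      (contDiffOn_mul_damping_rpow hε.le)) cutoffProduct_diag
      (fun q hq => subProfile_nonneg (p := p) hε.le hq) hM₁ hM₁₁ hM₁₂
    obtain ⟨φ₂, hφ₂, hφ₂0, hφ₂M, hφ₂lim, hΦ₂, hφ₂g⟩ := exists_isTestFunction_tendsto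
      (F := superProfile p ε) hΩo hp.le hVgrad hvi hVLp hc hcv hwLp.1 hGLp hψ hψw hψG (contDiffOn_cutoffProduct contDiffOn_rpow_Ioi
      (contDiffOn_rpow_mul_damping_rpow hε.le)) cutoffProduct_diag
      (fun q hq => superProfile_nonneg (p := p) hε.le hq) hM₂ hM₂₁ hM₂₂
    obtain ⟨hi₁, hle₁⟩ := integral_flux_le_of_tendsto hvol hp hD.memLp_grad hΦ₁
      (integrableOn_hardy_term hp hpN hΩb μ hD.memLp)
      (integrableOn_potential_term hp hpN hvol hf hD.memLp) hDineq hφ₁ hφ₁0 hφ₁M hφ₁lim hφ₁g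
    obtain ⟨hi₂, hle₂⟩ := integral_flux_le_of_tendsto hvol hp hW.memLp_grad hΦ₂
      (integrableOn_hardy_term hp hpN hΩb μ hW.memLp)
      (integrableOn_potential_term hp hpN hvol hg hW.memLp) hWineq hφ₂ hφ₂0 hφ₂M hφ₂lim hφ₂g
    have hI₁ := integrable_flux hp hD.memLp_grad hΦ₁
    have hI₂ := integrable_flux hp hW.memLp_grad hΦ₂
    -- By `abs_rpow_mul_subProfile` both equations are weighted equally: the Hardy terms cancel and
    -- `f - g` remains, times a nonnegative factor.
    have hrhs : ∫ x in Ω, (μ / ‖x‖ ^ p * (|u x| ^ (p - 2) * u x)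
          + f x * (|u x| ^ (p - 2) * u x)) * subProfile p ε (v x, v x + w x)
        + (μ / ‖x‖ ^ p * (|-v x| ^ (p - 2) * -v x)
          + g x * (|-v x| ^ (p - 2) * -v x)) * superProfile p ε (v x, v x + w x) ≤ 0 := by
      refine integral_nonpos_of_ae ?_
      filter_upwards [hcv, hfg] with x hx hfgx
      have hv0 : 0 < v x := hc.trans_le hx
      rcases le_or_gt (u x) (v x) with h | h
      · rw [hw_le x h]
        simp [subProfile, superProfile, cutoffProduct_diag]
      · rw [hw_gt x h, abs_neg]
        have hu0 : 0 < u x := hv0.trans h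
        have e := abs_rpow_mul_subProfile (p := p) (ε := ε) hv0 hu0
        have hnn : 0 ≤ |u x| ^ (p - 2) * u x * subProfile p ε (v x, u x) :=
          mul_nonneg (by positivity) (subProfile_nonneg hε.le hv0)
        have : (μ / ‖x‖ ^ p * (|u x| ^ (p - 2) * u x)
            + f x * (|u x| ^ (p - 2) * u x)) * subProfile p ε (v x, u x)
          + (μ / ‖x‖ ^ p * (|v x| ^ (p - 2) * -v x)
            + g x * (|v x| ^ (p - 2) * -v x)) * superProfile p ε (v x, u x)
          = (f x - g x) * (|u x| ^ (p - 2) * u x * subProfile p ε (v x, u x)) := by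
          linear_combination (μ / ‖x‖ ^ p + g x) * e
        rw [Pi.zero_apply, this]
        exact mul_nonpos_of_nonpos_of_nonneg (sub_nonpos.2 hfgx) hnn
    rw [integral_add hi₁ hi₂] at hrhs
    have hsum := (add_le_add hle₁ hle₂).trans hrhs
    rw [← integral_add hI₁ hI₂] at hsum
    -- Where $u\le v$ the right side is zero and the left side nonpositive; where $u>v$ this is
    -- `piconeGap_le_profiles`, the plus sign coming from `W = -V`.
    have hlow : ∀ᵐ x ∂(volume.restrict Ω),
        Q x - (p - 1) * ((1 - damping ε (v x + w x)) * ‖D x‖ ^ p)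
        ≤ ‖D x‖ ^ (p - 2) * inner ℝ (D x) (fderiv ℝ (subProfile p ε) (v x, v x + w x) (1, 0) • V x
            + fderiv ℝ (subProfile p ε) (v x, v x + w x) (0, 1) • (V x + G x))
          + ‖W x‖ ^ (p - 2) * inner ℝ (W x)
            (fderiv ℝ (superProfile p ε) (v x, v x + w x) (1, 0) • V x
            + fderiv ℝ (superProfile p ε) (v x, v x + w x) (0, 1) • (V x + G x)) := by
      filter_upwards [hcv, hGeq] with x hx hGx
      have hv0 : 0 < v x := hc.trans_le hx
      rcases le_or_gt (u x) (v x) with h | h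
      · have hz₁ : fderiv ℝ (subProfile p ε) (v x, v x) = 0 :=
          fderiv_eq_zero_of_nonneg (fun _ => subProfile_nonneg hε.le) hv0 (cutoffProduct_diag _)
        have hz₂ : fderiv ℝ (superProfile p ε) (v x, v x) = 0 :=
          fderiv_eq_zero_of_nonneg (fun _ => superProfile_nonneg hε.le) hv0 (cutoffProduct_diag _)
        have hd := sub_nonneg.2 (damping_le_one hε.le hv0.le)
        have hp1' : 0 ≤ p - 1 := by linarith
        simp only [hQ, hw_le x h, hz₁, hz₂, cutoff_of_le_one (div_self_le_one (v x)),
          zero_apply, zero_smul, add_zero, inner_zero_right, mul_zero, zero_mul, zero_sub]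
        rw [neg_nonpos]
        positivity
      · have hWV : W x = - V x := by simp [hVdef]
        have hP := piconeGap_le_profiles hp hε.le hε1 hv0 (hv0.trans h) (D x) (V x)
        simp only [hQ, hw_gt x h, hGx h, hWV, norm_neg, inner_neg_left, mul_neg]
        rw [← sub_eq_add_neg]
        exact hP
    have hdle : ∀ᵐ x ∂(volume.restrict Ω), ‖(1 - damping ε (v x + w x))‖ ≤ 1 := by
      filter_upwards [hUpos] with x hx
      have h1 := damping_pos hε.le hx.le
      have h2 := damping_le_one hε.le hx.le
      rw [Real.norm_of_nonneg (by linarith)]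
      linarith
    have hDi' : IntegrableOn (fun x => (p - 1) * ((1 - damping ε (v x + w x)) * ‖D x‖ ^ p)) Ω :=
      (hDp.bdd_mul ((hdampm ε).const_sub 1).aestronglyMeasurable hdle).const_mul (p - 1)
    -- Integrability of `Q` is a consequence of the upper bound `hlow`.
    have hQi : IntegrableOn Q Ω := by
      refine ((hI₁.add hI₂).add hDi').mono' hQm.aestronglyMeasurable ?_
      filter_upwards [hQ0, hlow] with x h1 h2
      rw [Real.norm_of_nonneg h1]
      simp only [Pi.add_apply]
      linarith
    refine ⟨hQi, ?_⟩
    have h := (integral_mono_ae (hQi.sub hDi') (hI₁.add hI₂) hlow).trans hsum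
    simp only [Pi.sub_apply] at h
    rw [integral_sub hQi hDi', integral_const_mul] at h
    linarith
  have hQint : IntegrableOn Q Ω := (key 1 one_pos le_rfl).1
  have hQzero : ∫ x in Ω, Q x = 0 := by
    refine le_antisymm ?_ (integral_nonneg_of_ae hQ0)
    -- The damping factor tends to 1 pointwise, with $|D|^p$ as dominating function.
    have hlim : Tendsto (fun n : ℕ => (p - 1) *
        ∫ x in Ω, (1 - damping (1 / ((n : ℝ) + 1)) (v x + w x)) * ‖D x‖ ^ p) atTop
        (𝓝 ((p - 1) * ∫ _ in Ω, (0 : ℝ))) := by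
      refine Tendsto.const_mul _ ?_
      refine tendsto_integral_of_dominated_convergence (fun x => ‖D x‖ ^ p) (fun n => ?_) hDp
        (fun n => ?_) ?_
      · exact ((hdampm _).const_sub 1).aestronglyMeasurable.mul hDp.1
      · filter_upwards [hUpos] with x hx
        have hn : (0 : ℝ) ≤ 1 / ((n : ℝ) + 1) := by positivity
        have h1 := damping_pos hn hx.le
        have h2 := damping_le_one hn hx.le
        have h3 : 0 ≤ ‖D x‖ ^ p := by positivity
        rw [Real.norm_of_nonneg (mul_nonneg (by linarith) h3)]
        exact mul_le_of_le_one_left h3 (by linarith)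
      · refine Eventually.of_forall fun x => ?_
        have h1 : Tendsto (fun n : ℕ => damping (1 / ((n : ℝ) + 1)) (v x + w x)) atTop
            (𝓝 ((1 + 0 * (v x + w x))⁻¹)) :=
          (((tendsto_one_div_add_atTop_nhds_zero_nat (𝕜 := ℝ)).mul_const _).const_add 1).inv₀
            (by simp)
        simpa using (h1.const_sub 1).mul_const (‖D x‖ ^ p)
    rw [integral_zero, mul_zero] at hlim
    refine ge_of_tendsto' hlim fun n => (key _ (by positivity) ?_).2
    rw [div_le_one (by positivity)]
    simp
  have hQae := (integral_eq_zero_iff_of_nonneg_ae hQ0 hQint).1 hQzero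
  have hlog : ∀ᵐ x ∂(volume.restrict Ω), v x < u x → (u x)⁻¹ • D x = (v x)⁻¹ • V x := by
    filter_upwards [hQae, hcv] with x hx hxc hlt
    have hv0 : 0 < v x := hc.trans_le hxc
    have hu0 : 0 < u x := hv0.trans hlt
    have hd := damping_pos zero_le_one hu0.le
    have hcut := cutoff_pos ((one_lt_div hv0).2 hlt)
    have hpos : 0 < damping 1 (u x) ^ p * damping 1 (u x) * u x ^ p * cutoff (u x / v x) := by
      positivity
    simp only [hQ, hw_gt x hlt, Pi.zero_apply] at hx
    exact eq_of_piconeGap_eq_zero hp ((mul_eq_zero.1 hx).resolve_left hpos.ne')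
  -- the cut-off quotient has vanishing gradient
  obtain ⟨M, hM, hM₁, hM₂⟩ := exists_bound_ratioProfile hc
  obtain ⟨φ, hφ, -, -, hφlim, -, hφg⟩ := exists_isTestFunction_tendsto
    (F := ratioProfile) hΩo hp.le hVgrad hvi hVLp hc hcv hwLp.1 hGLp hψ hψw hψG
    (contDiffOn_cutoffProduct contDiffOn_const contDiffOn_const) cutoffProduct_diag
    (fun q hq => ratioProfile_nonneg hq) hM hM₁ hM₂
  have hgz : ∀ᵐ x ∂(volume.restrict Ω), fderiv ℝ ratioProfile (v x, v x + w x) (1, 0) • V x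
      + fderiv ℝ ratioProfile (v x, v x + w x) (0, 1) • (V x + G x) = 0 := by
    filter_upwards [hcv, hGeq, hlog] with x hx hGx hlx
    have hv0 : 0 < v x := hc.trans_le hx
    rcases le_or_gt (u x) (v x) with h | h
    · have hz : fderiv ℝ ratioProfile (v x, v x) = 0 :=
        fderiv_eq_zero_of_nonneg (fun _ => ratioProfile_nonneg) hv0 (cutoffProduct_diag _)
      rw [hw_le x h, hz]
      simp
    · have hu0 : 0 < u x := hv0.trans h
      rw [hw_gt x h, hGx h, ← smul_inv_smul₀ hv0.ne' (V x), ← smul_inv_smul₀ hu0.ne' (D x),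
        fderiv_ratioProfile_combination hv0, hlx h, sub_self, smul_zero]
  have hφ0 : Tendsto (fun n => eLpNorm (∇ (φ n)) (ENNReal.ofReal p) (volume.restrict Ω))
      atTop (𝓝 0) := by
    refine hφg.congr fun n => eLpNorm_congr_ae ?_
    filter_upwards [hgz] with x hx
    rw [hx, sub_zero]
  -- The limit is `cutoff ((v + w) / v)`, which is strictly positive wherever $u>v$.
  have hzero := ae_eq_zero_of_tendsto_gradient hN2 hvol hp.le hφ hφlim hφ0
  filter_upwards [hzero, hcv] with x hx hxc
  by_contra! hlt
  have hv0 : 0 < v x := hc.trans_le hxc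
  rw [hw_gt x hlt] at hx
  have hpos := cutoff_pos ((one_lt_div hv0).2 hlt)
  simp only [ratioProfile, cutoffProduct, one_mul] at hx
  exact hpos.ne' hx
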